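/- **Setting.** Let $\sigma_1,\dots,\sigma_{b-1}$ be the standard generators of the braid group on $b$ strings, where $\sigma_i$ is a positive crossing of the $i$-th and $(i+1)$-th strings. A transverse braid is a closed braid about the $z$-axis in $(S^3,\ker(dz-y\,dx+x\,dy))$, given by a braid word; $L$ denotes both the closed braid and its diagram. Let $CKh(L)=\bigoplus_{v\in\{0,1\}^n}U^{\otimes\{\text{circles of }L_v\}}$ be the Khovanov complex over $\mathbb Z$ of a diagram with $n$ crossings. Here $U$ is free on ${\bf u}_+,{\bf u}_-$, and the differential is $d=\sum_e(-1)^{s(e)}d_e$, where $e$ runs over the edges of the cube, $s(e)$ is the number of $1$'s preceding the coordinate that changes along $e$, and $d_e$ is given by $$m({\bf u}_+\otimes{\bf u}_+)={\bf u}_+,\quad m({\bf u}_\pm\otimes{\bf u}_\mp)={\bf u}_-,\quad m({\bf u}_-\otimes{\bf u}_-)=0$$ when two circles merge, and by $$\Delta({\bf u}_+)={\bf u}_+\otimes{\bf u}_-+{\bf u}_-\otimes{\bf u}_+,\quad \Delta({\bf u}_-)={\bf u}_-\otimes{\bf u}_-$$ when a circle splits. $Kh(L)$ is the homology of $CKh(L)$.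 For a closed braid $L$ on $b$ strings, let $\psi(L)\in Kh(L)$ be the class of the cycle ${\bf u}_-\otimes\dots\otimes{\bf u}_-\in U^{\otimes b}$ placed at the oriented resolution (positive crossings $0$-resolved, negative crossings $1$-resolved). **The map $f_S$.** Let $L^2$ be obtained from the closed braid $L^1$ by $0$-resolving one positive crossing $x$, i.e. by deleting one letter $\sigma_i$ of the braid word. The resolution cobordism $S$ from $L^1$ to $L^2$ is the union of two elementary cobordisms: * an oriented $1$-handle attached along the two arcs immediately below and above $x$ on one of the two strings at $x$ (on the outer side of $x$; either string may be chosen), which gives a diagram $K$ that is $L^2$ with a positive kink at $x$ on the other string; * the Reidemeister move (R1) from $K$ to $L^2$ that removes this kink. The first part induces the chain map $h:CKh(L^1)\to CKh(K)$ that is $m$ or $\Delta$ on each complete resolution. The inverse of the second part induces the chain map $\rho_1:CKh(L^2)\to CKh(K)$ into the $0$-resolution of $x$ given by $\rho_1({\bf u}_-)={\bf u}_-\otimes{\bf u}_-$, $\rho_1({\bf u}_+)={\bf u}_+\otimes{\bf u}_--{\bf u}_-\otimes{\bf u}_+$, where the first factor is the circle of the string carrying the kink, the second factor is the small circle of the kink,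 and the labels of all other circles are kept. **Theorem.** For every such $L^1$, every positive crossing $x$ of it, and either choice of the string, $h$ is a chain map and $\rho_1$ is a quasi-isomorphism, so that the induced map $$f_S=(\rho_1)_*^{-1}\circ h_*:Kh(L^1)\to Kh(L^2)$$ is well defined, and $$f_S(\psi(L^1))=\pm\psi(L^2).$$ -/

import Mathlib

open scoped Classical

noncomputable section

namespace Khov

/-! ## Link diagrams and their resolutions -/

/-- A link diagram with `n` ordered crossings, presented combinatorially and cut into short
segments.  `Pt` is the (finite) set of marked points on the diagram, away from the crossings.
A joint is an oriented crossingless arc of the diagram from the point `src j` to the point `tgt j`.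
The crossing `c` has the four ends `cross c 0, …, cross c 3`, listed counterclockwise
and starting from the incoming end of the lower strand (the planar diagram code `X[i,j,k,l]`). -/
structure Diagram (n : ℕ) where
  Pt : Type
  finitePt : Finite Pt
  Joint : Type
  src : Joint → Pt
  tgt : Joint → Pt
  cross : Fin n → Fin 4 → Pt

instance {n : ℕ} (D : Diagram n) : Finite D.Pt := D.finitePt

/-- The arcs of the complete resolution of `D` at the vertex `v` of the cube `{0,1}ⁿ`
(`false` is `0` and `true` is `1`): all joints, and at the crossing `X[i,j,k,l]` the arcs `i-j`,
`k-l` of its `0`-resolution or the arcs `i-l`, `j-k` of its `1`-resolution. -/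
inductive Diagram.Arc {n : ℕ} (D : Diagram n) (v : Fin n → Bool) : D.Pt → D.Pt → Prop
  | joint (j : D.Joint) : Diagram.Arc D v (D.src j) (D.tgt j)
  | zero₁ (c : Fin n) (h : v c = false) : Diagram.Arc D v (D.cross c 0) (D.cross c 1)
  | zero₂ (c : Fin n) (h : v c = false) : Diagram.Arc D v (D.cross c 2) (D.cross c 3)
  | one₁ (c : Fin n) (h : v c = true) : Diagram.Arc D v (D.cross c 0) (D.cross c 3)
  | one₂ (c : Fin n) (h : v c = true) : Diagram.Arc D v (D.cross c 1) (D.cross c 2)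

/-- Two points are equivalent when they lie on the same circle of the resolution `D_v`. -/
def Diagram.res {n : ℕ} (D : Diagram n) (v : Fin n → Bool) : Setoid D.Pt :=
  Relation.EqvGen.setoid (D.Arc v)

/-- The set of circles of the resolution `D_v`. -/
abbrev Diagram.Circle {n : ℕ} (D : Diagram n) (v : Fin n → Bool) : Type :=
  Quotient (D.res v)

/-! ## The Frobenius algebra `U` -/

/-- The two generators `u₊`, `u₋` of `U`. -/
inductive Gen
  | plus
  | minus

instance : Finite Gen :=
  Finite.of_surjective (fun b : Bool => if b then Gen.plus else Gen.minus) fun x => by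
    cases x
    · exact ⟨true, rfl⟩
    · exact ⟨false, rfl⟩

/-- `mulCoeff x y z` is the coefficient of `z` in `m (x ⊗ y)`. -/
def mulCoeff : Gen → Gen → Gen → ℤ
  | .plus, .plus, .plus => 1
  | .plus, .minus, .minus => 1
  | .minus, .plus, .minus => 1
  | _, _, _ => 0

/-- `comulCoeff x y z` is the coefficient of `y ⊗ z` in `Δ x`. -/
def comulCoeff : Gen → Gen → Gen → ℤ
  | .plus, .plus, .minus => 1
  | .plus, .minus, .plus => 1
  | .minus, .minus, .minus => 1
  | _, _, _ => 0

/-- Matrix coefficient of the map `U^{⊗ circles of r} → U^{⊗ circles of r'}` induced by a surgery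
that replaces two arcs by two others, where `r` and `r'` are the partitions of the points into
circles before and after the surgery.  The point `a` lies on one of the two old
arcs and `b` on the other one, and also `a` lies on one of the two new arcs and `b` on the other.
The surgery merges two circles when `a`, `b` lie on different circles before it, and then the
map is `m`; it splits a circle when `a`, `b` lie on different circles after it, and then the map is
`Δ`.  The labels of all other circles are kept. -/
def surgeryCoeff {P : Type} (r r' : Setoid P) (a b : P)
    (l : Quotient r → Gen) (l' : Quotient r' → Gen) : ℤ :=
  if ∀ p : P, ¬ r p a → ¬ r p b → l' (Quotient.mk r' p) = l (Quotient.mk r p) then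
    if ¬ r a b ∧ r' a b then
      mulCoeff (l (Quotient.mk r a)) (l (Quotient.mk r b)) (l' (Quotient.mk r' a))
    else if r a b ∧ ¬ r' a b then
      comulCoeff (l (Quotient.mk r a)) (l' (Quotient.mk r' a)) (l' (Quotient.mk r' b))
    else 0
  else 0

/-! ## The Khovanov complex and its homology -/

/-- The generators of `CKh(D)`: a vertex `v` of the cube and a labelling of the circles
of `D_v` by `u₊` and `u₋`. -/
abbrev Diagram.State {n : ℕ} (D : Diagram n) : Type :=
  Σ v : Fin n → Bool, (D.Circle v → Gen)

/-- The label of the circle through the point `p` in a labelled resolution. -/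
def Diagram.State.label {n : ℕ} {D : Diagram n} (s : D.State) (p : D.Pt) : Gen :=
  s.2 (Quotient.mk (D.res s.1) p)

/-- The chain group `CKh(D) = ⨁_v U^{⊗ circles of D_v}`, free over `ℤ` on the labelled
resolutions. -/
abbrev Diagram.CKh {n : ℕ} (D : Diagram n) : Type := D.State →₀ ℤ

/-- The linear map with matrix coefficients `c s t` (from the generator `s` to the generator
`t`). -/
def ofCoeff {S T : Type} [Finite T] (c : S → T → ℤ) : (S →₀ ℤ) →ₗ[ℤ] (T →₀ ℤ) :=
  Finsupp.linearCombination ℤ fun s => Finsupp.equivFunOnFinite.symm (c s)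

/-- The sign exponent `s(e)` of the edge of the cube that starts at `v` and changes
the crossing `c`: the number of `1`s in `v` before `c`. -/
def edgeExp {n : ℕ} (v : Fin n → Bool) (c : Fin n) : ℕ :=
  (Finset.univ.filter fun j : Fin n => j < c ∧ v j = true).card

/-- Matrix coefficients of the differential `d = ∑_e (-1)^{s(e)} d_e`. -/
def Diagram.dCoeff {n : ℕ} (D : Diagram n) (s t : D.State) : ℤ :=
  ∑ c : Fin n,
    if s.1 c = false ∧ t.1 = Function.update s.1 c true then
      (-1) ^ edgeExp s.1 c *
        surgeryCoeff (D.res s.1) (D.res t.1) (D.cross c 0) (D.cross c 2) s.2 t.2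
    else 0

/-- The differential of the Khovanov complex. -/
def Diagram.d {n : ℕ} (D : Diagram n) : D.CKh →ₗ[ℤ] D.CKh := ofCoeff D.dCoeff

/-- Khovanov homology `Kh(D)`: cycles modulo boundaries. -/
abbrev Diagram.Kh {n : ℕ} (D : Diagram n) : Type :=
  LinearMap.ker D.d ⧸ (LinearMap.range D.d).submoduleOf (LinearMap.ker D.d)

/-- The homology class of a cycle. -/
def Diagram.homClass {n : ℕ} (D : Diagram n) (x : D.CKh) (hx : D.d x = 0) : D.Kh :=
  Submodule.Quotient.mk ⟨x, LinearMap.mem_ker.2 hx⟩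

/-- Linear maps between Khovanov complexes that commute with the differentials. -/
def IsChainMap {n n' : ℕ} {D : Diagram n} {D' : Diagram n'} (f : D.CKh →ₗ[ℤ] D'.CKh) : Prop :=
  ∀ x, f (D.d x) = D'.d (f x)

/-- The map on homology induced by a chain map: `[x] ↦ [f x]`. -/
def IsChainMap.homMap {n n' : ℕ} {D : Diagram n} {D' : Diagram n'} {f : D.CKh →ₗ[ℤ] D'.CKh}
    (hf : IsChainMap f) : D.Kh →ₗ[ℤ] D'.Kh :=
  Submodule.mapQ _ _
    (f.restrict (p := LinearMap.ker D.d) (q := LinearMap.ker D'.d) (fun x hx => by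
      rw [LinearMap.mem_ker] at hx ⊢
      rw [← hf x, hx, map_zero]))
    (by
      rintro ⟨x, hx⟩ ⟨y, hy⟩
      exact ⟨f y, by rw [← hf y, hy]; rfl⟩)

/-- A chain map that induces an isomorphism on homology. -/
def IsQuasiIso {n n' : ℕ} {D : Diagram n} {D' : Diagram n'} (f : D.CKh →ₗ[ℤ] D'.CKh) : Prop :=
  ∃ hf : IsChainMap f, Function.Bijective hf.homMap

/-- The isomorphism on homology induced by a quasi-isomorphism. -/
def IsQuasiIso.homEquiv {n n' : ℕ} {D : Diagram n} {D' : Diagram n'} {f : D.CKh →ₗ[ℤ] D'.CKh}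
    (hf : IsQuasiIso f) : D.Kh ≃ₗ[ℤ] D'.Kh :=
  LinearEquiv.ofBijective hf.choose.homMap hf.choose_spec

/-! ## Elementary cobordisms: 1-handles and the Reidemeister move (R1) -/

/-- The diagram obtained by an oriented 1-handle attachment along the two joints `e` and `f`:
the arcs `src e → tgt e`, `src f → tgt f` are replaced by `src e → tgt f`, `src f → tgt e`. -/
def Diagram.handle {n : ℕ} (D : Diagram n) (e f : D.Joint) : Diagram n where
  Pt := D.Pt
  finitePt := D.finitePt
  Joint := D.Joint
  src := D.src
  tgt := fun j => D.tgt (Equiv.swap e f j)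
  cross := D.cross

/-- The chain-level map of a 1-handle attachment: `m` or `Δ` on each complete resolution. -/
def Diagram.handleMap {n : ℕ} (D : Diagram n) (e f : D.Joint) :
    D.CKh →ₗ[ℤ] (D.handle e f).CKh :=
  ofCoeff fun s t =>
    if h : t.1 = s.1 then
      surgeryCoeff (P := D.Pt) (D.res s.1) ((D.handle e f).res s.1) (D.src e) (D.src f)
        s.2 (h ▸ t.2)
    else 0

/-- The chain-level map `ρ₁ : CKh(D) → CKh(D')` of a Reidemeister move (R1) that adds to `D`
a positive kink with crossing `k` of `D'`.  Points of `D` are identified with points of `D'`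
by `φ`; `q` is a point of the strand of `D` to which the kink is added, and `c` is a point of the
loop of the kink, which is a separate circle when the crossing `k` is `0`-resolved.
The image of `ρ₁` lies in the part where `k` is `0`-resolved, and
`ρ₁ u₋ = u₋ ⊗ u₋`, `ρ₁ u₊ = u₊ ⊗ u₋ - u₋ ⊗ u₊`, where the first factor is the circle through `q`
and the second one the loop; all other circles keep their labels. -/
def rho₁ {n : ℕ} (D : Diagram n) (D' : Diagram (n + 1)) (k : Fin (n + 1))
    (φ : D.Pt → D'.Pt) (q : D.Pt) (c : D'.Pt) : D.CKh →ₗ[ℤ] D'.CKh :=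
  ofCoeff fun s t =>
    if t.1 k = false ∧ (∀ j : Fin n, t.1 (k.succAbove j) = s.1 j) then
      if t.label c = .minus ∧ (∀ p, t.label (φ p) = s.label p) then 1
      else if s.label q = .plus ∧ t.label (φ q) = .minus ∧ t.label c = .plus ∧
          (∀ p, ¬ D.res s.1 p q → t.label (φ p) = s.label p) then -1
      else 0
    else 0

/-! ## Closed braids -/

/-- A letter `σ_{gen}` (`positive = true`) or `σ_{gen}⁻¹` (`positive = false`) of a braid word on
`m + 1` strings; `σ_i` is a positive crossing between the strings `i` and `i + 1`. -/
structure Letter (m : ℕ) where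
  gen : Fin m
  positive : Bool

/-- A braid word of length `n` on `m + 1` strings. -/
abbrev BraidWord (m n : ℕ) : Type := Fin n → Letter m

/-- Marked points of the diagram of a closed braid: `lo k j` and `hi k j` lie on the `j`-th string
immediately below and above the `k`-th crossing (the braid is read upwards), and
`base j` is the point on the `j`-th string where the braid is closed up. -/
inductive BraidPt (m n : ℕ)
  | base (j : Fin (m + 1))
  | lo (k : Fin n) (j : Fin (m + 1))
  | hi (k : Fin n) (j : Fin (m + 1))

instance {m n : ℕ} : Finite (BraidPt m n) :=
  Finite.of_surjective
    (fun x : Fin (m + 1) ⊕ ((Fin n × Fin (m + 1)) ⊕ (Fin n × Fin (m + 1))) =>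
      match x with
      | .inl j => BraidPt.base j
      | .inr (.inl (k, j)) => BraidPt.lo k j
      | .inr (.inr (k, j)) => BraidPt.hi k j) fun y => by
    cases y with
    | base j => exact ⟨.inl j, rfl⟩
    | lo k j => exact ⟨.inr (.inl (k, j)), rfl⟩
    | hi k j => exact ⟨.inr (.inr (k, j)), rfl⟩

namespace BraidPt

/-- Between consecutive crossings, string `j` has the arc from `bottom t j` up to `top t j`.
The arc `t = 0` starts at the base point, below the first crossing. -/
def bottom {m n : ℕ} (t : Fin (n + 1)) (j : Fin (m + 1)) : BraidPt m n :=
  Fin.cases (base j) (fun k => hi k j) t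

/-- The upper end of the `t`-th arc on string `j`.  The arc `t = n` ends at the base point. -/
def top {m n : ℕ} (t : Fin (n + 1)) (j : Fin (m + 1)) : BraidPt m n :=
  Fin.lastCases (motive := fun _ => BraidPt m n) (base j) (fun k => lo k j) t

/-- The points of the diagram with the `k`-th crossing deleted, as points of the original
diagram. -/
def skip {m n : ℕ} (k : Fin (n + 1)) : BraidPt m n → BraidPt m (n + 1)
  | base j => base j
  | lo k' j => lo (k.succAbove k') j
  | hi k' j => hi (k.succAbove k') j

end BraidPt

/-- The arcs without crossings of a closed braid: the arcs between consecutive levels, and at each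
level the strings that do not take part in the crossing. -/
inductive BraidJoint {m n : ℕ} (w : BraidWord m n)
  | between (t : Fin (n + 1)) (j : Fin (m + 1))
  | through (k : Fin n) (j : Fin (m + 1)) (h₁ : j ≠ (w k).gen.castSucc) (h₂ : j ≠ (w k).gen.succ)

/-- The diagram of the closure of a braid word.  With all strings oriented upwards, the lower
strand of a positive crossing runs from the lower right to the upper left end, and the lower strand
of a negative crossing from the lower left to the upper right end. -/
def closure {m n : ℕ} (w : BraidWord m n) : Diagram n where
  Pt := BraidPt m n
  finitePt := inferInstance
  Joint := BraidJoint w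
  src
    | .between t j => .bottom t j
    | .through k j _ _ => .lo k j
  tgt
    | .between t j => .top t j
    | .through k j _ _ => .hi k j
  cross k :=
    if (w k).positive = true then
      ![.lo k (w k).gen.succ, .hi k (w k).gen.succ, .hi k (w k).gen.castSucc,
        .lo k (w k).gen.castSucc]
    else
      ![.lo k (w k).gen.castSucc, .lo k (w k).gen.succ, .hi k (w k).gen.succ,
        .hi k (w k).gen.castSucc]

/-! ## The invariant `ψ` -/

/-- The oriented resolution of a closed braid: positive crossings are `0`-resolved and negative
crossings `1`-resolved. -/
def orientedRes {m n : ℕ} (w : BraidWord m n) : Fin n → Bool := fun k => !(w k).positive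

/-- The chain `ψ̃ = u₋ ⊗ ⋯ ⊗ u₋` on the oriented resolution. -/
def psiChain {m n : ℕ} (w : BraidWord m n) : (closure w).CKh :=
  Finsupp.single ⟨orientedRes w, fun _ => .minus⟩ 1

/-- The string on which a marked point lies. -/
def BraidPt.string {m n : ℕ} : BraidPt m n → Fin (m + 1)
  | base j => j
  | lo _ j => j
  | hi _ j => j

theorem BraidPt.string_bottom {m n : ℕ} (t : Fin (n + 1)) (j : Fin (m + 1)) :
    (BraidPt.bottom t j : BraidPt m n).string = j := by
  refine Fin.cases ?_ (fun k => ?_) t <;> rfl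

theorem BraidPt.string_top {m n : ℕ} (t : Fin (n + 1)) (j : Fin (m + 1)) :
    (BraidPt.top t j : BraidPt m n).string = j := by
  refine Fin.lastCases ?_ (fun k => ?_) t <;> simp [BraidPt.top, BraidPt.string]

/-- In the oriented resolution the circles are the strings. -/
theorem string_eq_of_orientedRes {m n : ℕ} (w : BraidWord m n) {p q : BraidPt m n}
    (h : (closure w).res (orientedRes w) p q) : p.string = q.string := by
  have key : (closure w).res (orientedRes w) ≤ Setoid.ker BraidPt.string := by
    refine Setoid.eqvGen_le fun x y hxy => ?_
    show x.string = y.string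
    cases hxy with
    | joint j =>
      cases j with
      | between t j =>
        exact (BraidPt.string_bottom t j).trans (BraidPt.string_top t j).symm
      | through k j _ _ => rfl
    | zero₁ c h =>
      have hp : (w c).positive = true := by simpa [orientedRes] using h
      simp [closure, hp, BraidPt.string]
    | zero₂ c h =>
      have hp : (w c).positive = true := by simpa [orientedRes] using h
      simp [closure, hp, BraidPt.string]
    | one₁ c h =>
      have hp : (w c).positive = false := by simpa [orientedRes] using h
      simp [closure, hp, BraidPt.string]
    | one₂ c h =>
      have hp : (w c).positive = false := by simpa [orientedRes] using h
      simp [closure, hp, BraidPt.string]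
  exact key h

/-- `ψ̃` is a cycle. -/
theorem d_psiChain {m n : ℕ} (w : BraidWord m n) : (closure w).d (psiChain w) = 0 := by
  ext t
  simp only [Diagram.d, psiChain, ofCoeff, Finsupp.linearCombination_single, one_smul,
    Finsupp.equivFunOnFinite_symm_apply_apply, Diagram.dCoeff, Finsupp.coe_zero, Pi.zero_apply]
  refine Finset.sum_eq_zero fun c _ => ?_
  split_ifs with h
  · have hp : (w c).positive = true := by simpa [orientedRes] using h.1
    have hn : ¬ (closure w).res (orientedRes w) ((closure w).cross c 0)
        ((closure w).cross c 2) := by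
      intro hr
      have := string_eq_of_orientedRes w hr
      simp [closure, hp, BraidPt.string, Fin.ext_iff] at this
    have hm : ∀ z, mulCoeff .minus .minus z = 0 := by intro z; cases z <;> rfl
    simp [surgeryCoeff, hn, hm]
  · rfl

/-- The element `ψ(L) ∈ Kh(L)` of the closed braid `L`. -/
def psi {m n : ℕ} (w : BraidWord m n) : (closure w).Kh :=
  (closure w).homClass (psiChain w) (d_psiChain w)

/-! ## Resolving a positive crossing -/

/-- The braid word with the `k`-th letter deleted, which represents the closed braid with
the `k`-th crossing replaced by its oriented resolution. -/
def resolve {m n : ℕ} (w : BraidWord m (n + 1)) (k : Fin (n + 1)) : BraidWord m n :=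
  fun j => w (k.succAbove j)

/-- The two strings at the `k`-th crossing: the left or the right one. -/
def stringAt {m n : ℕ} (w : BraidWord m n) (k : Fin n) (left : Bool) : Fin (m + 1) :=
  if left then (w k).gen.castSucc else (w k).gen.succ

/-- The intermediate diagram of the resolution cobordism.  A 1-handle is attached on the left (or
right) side of the crossing `k`, joining the arcs immediately below and above the crossing at the
left (right) string.  This splits off that string from the crossing, which becomes
a positive kink on the other string. -/
def kinked {m n : ℕ} (w : BraidWord m (n + 1)) (k : Fin (n + 1)) (left : Bool) :
    Diagram (n + 1) :=
  (closure w).handle (.between k.castSucc (stringAt w k left)) (.between k.succ (stringAt w k left))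

/-- The chain map of the first part of the resolution cobordism: the 1-handle. -/
def handlePart {m n : ℕ} (w : BraidWord m (n + 1)) (k : Fin (n + 1)) (left : Bool) :
    (closure w).CKh →ₗ[ℤ] (kinked w k left).CKh :=
  (closure w).handleMap (.between k.castSucc (stringAt w k left))
    (.between k.succ (stringAt w k left))

/-- The map `ρ₁` of the (R1) move from the resolved braid to the kinked diagram.  The
second part of the resolution cobordism is the inverse of this move. -/
def kinkPart {m n : ℕ} (w : BraidWord m (n + 1)) (k : Fin (n + 1)) (left : Bool) :
    (closure (resolve w k)).CKh →ₗ[ℤ] (kinked w k left).CKh :=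
  rho₁ (closure (resolve w k)) (kinked w k left) k (BraidPt.skip k)
    (BraidPt.bottom k (stringAt w k !left)) (BraidPt.lo k (stringAt w k left))

/-- The map `f_S : Kh(L¹) → Kh(L²)` of the resolution cobordism `S`: the 1-handle attachment
followed by the (R1) move that removes the kink. -/
def resolutionMap {m n : ℕ} {w : BraidWord m (n + 1)} {k : Fin (n + 1)} {left : Bool}
    (hh : IsChainMap (handlePart w k left)) (hk : IsQuasiIso (kinkPart w k left)) :
    (closure w).Kh →ₗ[ℤ] (closure (resolve w k)).Kh :=
  hk.homEquiv.symm.toLinearMap ∘ₗ hh.homMap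

end Khov

end

/-! The equality holds at chain level, with sign `+`. In the oriented resolution the circles are the
strings, and the handle joins two arcs of one string. It therefore splits a circle, and `Δ u₋ = u₋ ⊗
u₋` sends the all-`u₋` chain to the all-`u₋` chain (`handlePart_psiChain`). On the other side `ρ₁ u₋
= u₋ ⊗ u₋` sends the all-`u₋` chain of the resolved braid to the same element (`kinkPart_psiChain`).
Most of the work is to show that `h` is a chain map and that `ρ₁` is a quasi-isomorphism.

Algebra of surgeries. Each point acts on a tensor power of `U` through multiplication by `u₋` on its
circle (`dot`), and surgery maps respect this action (`surgery_dot`). The tensor power is generated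
by `u₊ ⊗ ⋯ ⊗ u₊` under the action, so identities between such maps need checking only there
(`linearMap_ext_unit`). In this way `surgery_comm` shows that two surgeries commute whenever each of
the four steps is a merge or a split. Applied to the handle and a crossing, it gives the chain map
property.

Excluding surgeries that turn one circle into one circle. The diagrams are purely combinatorial, so
this needs a substitute for planarity. Orient the strings alternately up and down. An arc through a
crossing stays on its string, and an arc that turns back joins neighbouring strings, so every
resolution is coherently oriented and its circles are the cycles of a permutation. Changing a
crossing, or attaching a handle to two arcs of one string, multiplies this permutation by a
transposition, which always merges two cycles or splits one (`sameCycle_mul_swap`).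

The move (R1). Write `CKh(D')` as `C₋ ⊕ C₊ ⊕ C'`: the kink crossing is `0`-resolved with the loop
labelled `u₋` or `u₊`, or it is `1`-resolved. Each summand is a copy of `CKh(D)`. The kink edge `C₊
→ C'` is an isomorphism because `m (x ⊗ u₊) = x`, and `C₋ → C'` is multiplication by `u₋` at the
strand, both up to sign. Hence `ρ₁ z = (z, -u₋ z, 0)` is a chain map, and cancelling `C₊` against
`C'` shows that it is a quasi-isomorphism (`isQuasiIso_rho₁`). That the intermediate diagram is such
a kink is `isKink_kinked`. -/

noncomputable section

namespace Khov

/-! ## Partitions related by a surgery -/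

/-- The partition obtained from `r` by joining the classes of `a` and `b`. -/
def glue {P : Type} (r : Setoid P) (a b : P) : Setoid P where
  r x y := r x y ∨ (r x a ∧ r b y) ∨ (r x b ∧ r a y)
  iseqv :=
    { refl := fun x => Or.inl (r.refl x)
      symm := by
        rintro x y (h | ⟨h, h'⟩ | ⟨h, h'⟩)
        · exact Or.inl (r.symm h)
        · exact Or.inr (Or.inr ⟨r.symm h', r.symm h⟩)
        · exact Or.inr (Or.inl ⟨r.symm h', r.symm h⟩)
      trans := by
        rintro x y z (h | ⟨h, h'⟩ | ⟨h, h'⟩) (k | ⟨k, k'⟩ | ⟨k, k'⟩)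
        · exact Or.inl (r.trans h k)
        · exact Or.inr (Or.inl ⟨r.trans h k, k'⟩)
        · exact Or.inr (Or.inr ⟨r.trans h k, k'⟩)
        · exact Or.inr (Or.inl ⟨h, r.trans h' k⟩)
        · exact Or.inr (Or.inl ⟨h, k'⟩)
        · exact Or.inl (r.trans h k')
        · exact Or.inr (Or.inr ⟨h, r.trans h' k⟩)
        · exact Or.inl (r.trans h k')
        · exact Or.inr (Or.inr ⟨h, k'⟩) }

theorem glue_le {P : Type} {r s : Setoid P} {a b : P} (h : r ≤ s) (hab : s a b) :
    glue r a b ≤ s := by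
  rintro x y (k | ⟨k, k'⟩ | ⟨k, k'⟩)
  · exact h k
  · exact s.trans (h k) (s.trans hab (h k'))
  · exact s.trans (h k) (s.trans (s.symm hab) (h k'))

/-- The partitions `r` and `r'` agree once the classes of `a` and `b` are joined. -/
structure IsSurgery {P : Type} (r r' : Setoid P) (a b : P) : Prop where
  le : r ≤ glue r' a b
  ge : r' ≤ glue r a b

namespace IsSurgery

variable {P : Type} {r r' : Setoid P} {a b : P}

theorem symm (h : IsSurgery r r' a b) : IsSurgery r' r a b := ⟨h.ge, h.le⟩

/-- Joining classes that are already equal changes nothing. Thus a merge only coarsens the partition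
and, by symmetry, a split only refines it. -/
theorem le_of_rel (h : IsSurgery r r' a b) (hab : r' a b) : r ≤ r' :=
  h.le.trans (glue_le le_rfl hab)

/-- A class that meets neither `a` nor `b` is not affected by the gluing, so it is the same before
and after. This is what makes it meaningful to keep the labels of all other circles. -/
theorem rel_iff (h : IsSurgery r r' a b) {p q : P} (ha : ¬ r p a) (hb : ¬ r p b) :
    r' p q ↔ r p q := by
  constructor
  · intro k
    rcases h.ge k with k | k | k
    · exact k
    · exact absurd k.1 ha
    · exact absurd k.1 hb
  · intro k
    rcases h.le k with k' | ⟨k', k''⟩ | ⟨k', k''⟩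
    · exact k'
    · rcases h.ge k' with k | k | k
      · exact absurd k ha
      · exact absurd k.1 ha
      · exact absurd k.1 hb
    · rcases h.ge k' with k | k | k
      · exact absurd k hb
      · exact absurd k.1 ha
      · exact absurd k.1 hb

end IsSurgery

/-! ## The action of the points on labellings -/

/-- The tensor power of `U` indexed by the classes of a partition. -/
abbrev TensorPower {P : Type} (r : Setoid P) : Type := (Quotient r → Gen) →₀ ℤ

theorem update_mk {P : Type} (r : Setoid P) (l : Quotient r → Gen) (p q : P) (g : Gen) :
    Function.update l (Quotient.mk r p) g (Quotient.mk r q) =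
      if r q p then g else l (Quotient.mk r q) := by
  by_cases h : r q p
  · rw [if_pos h, Quotient.sound h, Function.update_self]
  · rw [if_neg h, Function.update_of_ne]
    intro h'
    exact h (Quotient.exact h')

theorem mk_congr {P : Type} {r : Setoid P} {p q : P} (h : r p q) :
    Quotient.mk r p = Quotient.mk r q := Quotient.sound h

theorem Gen.ne_plus {g : Gen} : g ≠ .plus ↔ g = .minus := by cases g <;> simp

theorem Gen.ne_minus {g : Gen} : g ≠ .minus ↔ g = .plus := by cases g <;> simp

/-- Multiplication by `u₋` in the factor of the class of `p`. -/
def dot {P : Type} (r : Setoid P) (p : P) : TensorPower r →ₗ[ℤ] TensorPower r :=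
  Finsupp.linearCombination ℤ fun l =>
    if l (Quotient.mk r p) = .plus then
      Finsupp.single (Function.update l (Quotient.mk r p) .minus) 1 else 0

theorem dot_single {P : Type} (r : Setoid P) (p : P) (l : Quotient r → Gen) :
    dot r p (Finsupp.single l 1) = if l (Quotient.mk r p) = .plus then
      Finsupp.single (Function.update l (Quotient.mk r p) .minus) 1 else 0 := by
  simp [dot]

theorem dot_apply {P : Type} (r : Setoid P) (p : P) (x : TensorPower r) (l : Quotient r → Gen) :
    dot r p x l = if l (Quotient.mk r p) = .minus then
      x (Function.update l (Quotient.mk r p) .plus) else 0 := by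
  induction x using Finsupp.induction_linear with
  | zero => simp
  | add x y hx hy => rw [map_add, Finsupp.add_apply, hx, hy, Finsupp.add_apply]; split_ifs <;> simp
  | single k c =>
    have hc : (Finsupp.single k c : TensorPower r) = c • Finsupp.single k 1 := by simp
    rw [hc, map_smul, dot_single, Finsupp.smul_apply, Finsupp.smul_apply]
    -- Lowering the label at `p` is a bijection from the labellings with `u₊` there to those with
    -- `u₋` there, so each coefficient of the image comes from a single coefficient.
    have key : (k (Quotient.mk r p) = .plus ∧ Function.update k (Quotient.mk r p) .minus = l) ↔
        (l (Quotient.mk r p) = .minus ∧ k = Function.update l (Quotient.mk r p) .plus) := by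
      constructor
      · rintro ⟨h, rfl⟩
        refine ⟨by simp, ?_⟩
        rw [Function.update_idem, ← h, Function.update_eq_self]
      · rintro ⟨h, rfl⟩
        refine ⟨by simp, ?_⟩
        rw [Function.update_idem, ← h, Function.update_eq_self]
    by_cases h1 : k (Quotient.mk r p) = .plus
    · by_cases h2 : l (Quotient.mk r p) = .minus
      · simp only [h1, h2, true_and] at key
        simp [h1, h2, Finsupp.single_apply, key]
      · simp only [h1, h2, true_and, false_and, iff_false] at key
        simp [h1, h2, key]
    · by_cases h2 : l (Quotient.mk r p) = .minus
      · simp only [h1, h2, true_and, false_and, false_iff] at key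
        simp [h1, h2, key]
      · simp [h1, h2]

theorem dot_congr {P : Type} {r : Setoid P} {p q : P} (h : r p q) : dot r p = dot r q := by
  unfold dot
  rw [mk_congr h]

theorem dot_comm {P : Type} (r : Setoid P) (p q : P) (x : TensorPower r) :
    dot r p (dot r q x) = dot r q (dot r p x) := by
  by_cases h : r p q
  · rw [dot_congr h]
  · have h' : ¬ r q p := fun k => h (r.symm k)
    ext l
    simp only [dot_apply, update_mk, h, h', if_false]
    rw [Function.update_comm (fun k => h' (Quotient.exact k))]
    split_ifs <;> rfl

/-- The element `u₊ ⊗ ⋯ ⊗ u₊`. -/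
def unit {P : Type} (r : Setoid P) : TensorPower r := Finsupp.single (fun _ => .plus) 1

/-- A linear map that is compatible with the actions of the points is determined by its value at
`u₊ ⊗ ⋯ ⊗ u₊`. -/
theorem linearMap_ext_unit {P M : Type} [Finite P] {r : Setoid P} [AddCommGroup M]
    {F G : TensorPower r →ₗ[ℤ] M} (T : P → M →ₗ[ℤ] M)
    (hF : ∀ p x, F (dot r p x) = T p (F x)) (hG : ∀ p x, G (dot r p x) = T p (G x))
    (h : F (unit r) = G (unit r)) : F = G := by
  have : Fintype (Quotient r) := Fintype.ofFinite _
  -- Induction on the number of labels `u₋`: a labelling with `u₋` at `p` is `dot r p` of the same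
  -- labelling with `u₊` there.
  have key : ∀ (N : ℕ) (l : Quotient r → Gen),
      (Finset.univ.filter fun c => l c = .minus).card = N →
      F (Finsupp.single l 1) = G (Finsupp.single l 1) := by
    intro N
    induction N with
    | zero =>
      intro l hl
      have : l = fun _ => .plus := by
        funext c
        rw [← Gen.ne_minus]
        intro hc
        rw [Finset.card_eq_zero] at hl
        have : c ∈ (∅ : Finset (Quotient r)) := by rw [← hl]; simp [hc]
        simp at this
      rw [this]
      exact h
    | succ N ih =>
      intro l hl
      obtain ⟨c, hc⟩ : (Finset.univ.filter fun c => l c = .minus).Nonempty := by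
        rw [← Finset.card_pos]; omega
      have hc' : l c = .minus := by simpa using hc
      obtain ⟨p, rfl⟩ := Quotient.exists_rep c
      have e : (Finsupp.single l 1 : TensorPower r) =
          dot r p (Finsupp.single (Function.update l (Quotient.mk r p) .plus) 1) := by
        rw [dot_single, if_pos (by simp), Function.update_idem, ← hc', Function.update_eq_self]
      have hN : (Finset.univ.filter fun c =>
          Function.update l (Quotient.mk r p) .plus c = .minus).card = N := by
        have : (Finset.univ.filter fun c =>
            Function.update l (Quotient.mk r p) .plus c = .minus) =
            (Finset.univ.filter fun c => l c = .minus).erase (Quotient.mk r p) := by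
          ext c
          by_cases hcp : c = Quotient.mk r p
          · simp [hcp]
          · simp [hcp]
        rw [this, Finset.card_erase_of_mem hc, hl]
        rfl
      rw [e, hF, hG, ih _ hN]
  refine Finsupp.lhom_ext' fun l => LinearMap.ext_ring ?_
  exact key _ l rfl

/-! ## Surgery maps -/

theorem ofCoeff_single {S T : Type} [Finite T] (c : S → T → ℤ) (s : S) (t : T) :
    ofCoeff c (Finsupp.single s 1) t = c s t := by
  simp [ofCoeff]

/-- The map between tensor powers induced by a surgery. -/
def surgery {P : Type} [Finite P] (r r' : Setoid P) (a b : P) :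
    TensorPower r →ₗ[ℤ] TensorPower r' :=
  ofCoeff (surgeryCoeff r r' a b)

theorem surgeryCoeff_update_left {P : Type} {r r' : Setoid P} {a b : P} {p : P}
    (hp : p = a ∨ p = b) (g : Gen) (l : Quotient r → Gen) (l' : Quotient r' → Gen) :
    (∀ q : P, ¬ r q a → ¬ r q b →
      l' (Quotient.mk r' q) = Function.update l (Quotient.mk r p) g (Quotient.mk r q)) ↔
    (∀ q : P, ¬ r q a → ¬ r q b → l' (Quotient.mk r' q) = l (Quotient.mk r q)) := by
  refine forall_congr' fun q => forall_congr' fun ha => forall_congr' fun hb => ?_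
  rw [update_mk, if_neg]
  rcases hp with rfl | rfl <;> assumption

theorem surgeryCoeff_update_right {P : Type} {r r' : Setoid P} {a b : P}
    (h : IsSurgery r r' a b) {p : P}
    (hp : p = a ∨ p = b) (g : Gen) (l : Quotient r → Gen) (l' : Quotient r' → Gen) :
    (∀ q : P, ¬ r q a → ¬ r q b →
      Function.update l' (Quotient.mk r' p) g (Quotient.mk r' q) = l (Quotient.mk r q)) ↔
    (∀ q : P, ¬ r q a → ¬ r q b → l' (Quotient.mk r' q) = l (Quotient.mk r q)) := by
  refine forall_congr' fun q => forall_congr' fun ha => forall_congr' fun hb => ?_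
  rw [update_mk, if_neg]
  rw [h.rel_iff ha hb]
  rcases hp with rfl | rfl <;> assumption

theorem surgery_eq_zero {P : Type} [Finite P] {r r' : Setoid P} {a b : P}
    (h : r a b ↔ r' a b) : surgery r r' a b = 0 := by
  refine Finsupp.lhom_ext' fun l => LinearMap.ext_ring ?_
  ext l'
  simp only [LinearMap.comp_apply, Finsupp.lsingle_apply, surgery, ofCoeff_single, surgeryCoeff,
    LinearMap.zero_apply, Finsupp.coe_zero, Pi.zero_apply]
  split_ifs <;> first | rfl | (exfalso; tauto)

/-- The matrix of `dot` has at most one nonzero entry in each row and column, so both matrix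
products reduce to a single term. -/
theorem surgery_dot_of_coeff {P : Type} [Finite P] {r r' : Setoid P} {a b p p' : P}
    (h : ∀ (l : Quotient r → Gen) (l' : Quotient r' → Gen),
      (if l (Quotient.mk r p) = .plus then
        surgeryCoeff r r' a b (Function.update l (Quotient.mk r p) .minus) l' else 0) =
      if l' (Quotient.mk r' p') = .minus then
        surgeryCoeff r r' a b l (Function.update l' (Quotient.mk r' p') .plus) else 0)
    (x : TensorPower r) :
    surgery r r' a b (dot r p x) = dot r' p' (surgery r r' a b x) := by
  suffices h' : surgery r r' a b ∘ₗ dot r p = dot r' p' ∘ₗ surgery r r' a b from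
    LinearMap.congr_fun h' x
  refine Finsupp.lhom_ext' fun l => LinearMap.ext_ring ?_
  ext l'
  simp only [LinearMap.comp_apply, Finsupp.lsingle_apply, dot_single, dot_apply]
  have h := h l l'
  simp only [surgery, ofCoeff_single]
  rw [← h]
  split_ifs
  · rw [ofCoeff_single]
  · simp

/-- Surgery maps are compatible with the action of the points. -/
theorem surgery_dot {P : Type} [Finite P] {r r' : Setoid P} {a b : P}
    (h : IsSurgery r r' a b) (p : P) (x : TensorPower r) :
    surgery r r' a b (dot r p x) = dot r' p (surgery r r' a b x) := by
  -- On an untouched circle the action changes only a label that the surgery copies.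
  by_cases hp : ¬ r p a ∧ ¬ r p b
  · obtain ⟨ha, hb⟩ := hp
    refine surgery_dot_of_coeff (fun l l' => ?_) x
    have ha' : ¬ r a p := fun k => ha (r.symm k)
    have hb' : ¬ r b p := fun k => hb (r.symm k)
    have ka : ¬ r' a p := fun k => ha ((h.rel_iff ha hb).1 (r'.symm k))
    have kb : ¬ r' b p := fun k => hb ((h.rel_iff ha hb).1 (r'.symm k))
    have key : (l (Quotient.mk r p) = .plus ∧ ∀ q : P, ¬ r q a → ¬ r q b →
        l' (Quotient.mk r' q) =
          Function.update l (Quotient.mk r p) .minus (Quotient.mk r q)) ↔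
        (l' (Quotient.mk r' p) = .minus ∧ ∀ q : P, ¬ r q a → ¬ r q b →
        Function.update l' (Quotient.mk r' p) .plus (Quotient.mk r' q) =
          l (Quotient.mk r q)) := by
      simp only [update_mk]
      constructor
      · rintro ⟨h1, h2⟩
        refine ⟨by simpa using h2 p ha hb, fun q hqa hqb => ?_⟩
        have := h2 q hqa hqb
        rw [h.rel_iff hqa hqb]
        split_ifs at this ⊢ with hq
        · rw [mk_congr hq, h1]
        · exact this
      · rintro ⟨h1, h2⟩
        refine ⟨by simpa using (h2 p ha hb).symm, fun q hqa hqb => ?_⟩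
        have := h2 q hqa hqb
        rw [h.rel_iff hqa hqb] at this
        split_ifs at this ⊢ with hq
        · rw [mk_congr ((h.rel_iff hqa hqb).2 hq), h1]
        · exact this
    simp only [surgeryCoeff, update_mk r l p a, update_mk r l p b, update_mk r' l' p a,
      update_mk r' l' p b, ha', hb', ka, kb, if_false]
    simp only [← ite_and]
    rw [if_congr key rfl rfl]
  · have hor : r p a ∨ r p b := by tauto
    rcases (by tauto : (r a b ∧ ¬ r' a b) ∨ (¬ r a b ∧ r' a b) ∨ (r a b ↔ r' a b)) with ⟨hab, hab'⟩ | ⟨hab, hab'⟩ | h0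
    -- After a split `p` lies on the new circle of `a` or of `b`, so it can be replaced by that
    -- point. The claim becomes `Δ (u₋ x) = u₋ · Δ x`, with `u₋` acting on the chosen factor.
    · have key : ∃ c, (c = a ∨ c = b) ∧ r' p c := by
        rcases hor with k | k
        · rcases h.le k with k | k | k
          exacts [⟨a, by simp, k⟩, ⟨a, by simp, k.1⟩, ⟨b, by simp, k.1⟩]
        · rcases h.le k with k | k | k
          exacts [⟨b, by simp, k⟩, ⟨a, by simp, k.1⟩, ⟨b, by simp, k.1⟩]
      obtain ⟨c, hc, hpc⟩ := key
      rw [dot_congr hpc, dot_congr (h.symm.le_of_rel hab hpc)]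
      refine surgery_dot_of_coeff (fun l l' => ?_) x
      simp only [surgeryCoeff, surgeryCoeff_update_left hc, surgeryCoeff_update_right h hc]
      have hba' : ¬ r' b a := fun k => hab' (r'.symm k)
      have e : Quotient.mk r a = Quotient.mk r b := mk_congr hab
      simp only [hab, hab', not_true_eq_false, not_false_eq_true, and_true, and_false,
        if_true, if_false]
      by_cases C : ∀ q : P, ¬ r q a → ¬ r q b → l' (Quotient.mk r' q) = l (Quotient.mk r q)
      · rw [if_pos C, if_pos C]
        rcases hc with rfl | rfl
        · simp only [update_mk, r.refl, r'.refl, hba', if_true, if_false]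
          cases l (Quotient.mk r c) <;> cases l' (Quotient.mk r' c) <;>
            cases l' (Quotient.mk r' b) <;> simp [comulCoeff]
        · simp only [update_mk, r.refl, r'.refl, hab', if_true, if_false, e]
          cases l (Quotient.mk r c) <;> cases l' (Quotient.mk r' c) <;>
            cases l' (Quotient.mk r' a) <;> simp [comulCoeff]
      · rw [if_neg C, if_neg C, ite_self, ite_self]
    -- Before a merge `p` lies on the circle of `a` or of `b`. The claim becomes `m (u₋ x ⊗ y) = u₋
    -- m (x ⊗ y)` or its mirror image.
    · obtain ⟨c, hc, hpc⟩ : ∃ c, (c = a ∨ c = b) ∧ r p c := by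
        rcases hor with k | k
        exacts [⟨a, by simp, k⟩, ⟨b, by simp, k⟩]
      rw [dot_congr hpc, dot_congr (h.le_of_rel hab' hpc)]
      refine surgery_dot_of_coeff (fun l l' => ?_) x
      simp only [surgeryCoeff, surgeryCoeff_update_left hc, surgeryCoeff_update_right h hc]
      have hba : ¬ r b a := fun k => hab (r.symm k)
      have e : Quotient.mk r' a = Quotient.mk r' b := mk_congr hab'
      simp only [hab, hab', not_true_eq_false, not_false_eq_true, and_true,
        if_true]
      by_cases C : ∀ q : P, ¬ r q a → ¬ r q b → l' (Quotient.mk r' q) = l (Quotient.mk r q)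
      · rw [if_pos C, if_pos C]
        rcases hc with rfl | rfl
        · simp only [update_mk, r.refl, r'.refl, hba, if_true, if_false]
          cases l (Quotient.mk r c) <;> cases l (Quotient.mk r b) <;>
            cases l' (Quotient.mk r' c) <;> simp [mulCoeff]
        · simp only [update_mk, r.refl, hab, if_true, if_false, e]
          cases l (Quotient.mk r c) <;> cases l (Quotient.mk r a) <;>
            cases l' (Quotient.mk r' c) <;> simp [mulCoeff]
      · rw [if_neg C, if_neg C, ite_self, ite_self]
    · rw [surgery_eq_zero h0]
      simp

theorem surgery_unit_of_merge {P : Type} [Finite P] {r r' : Setoid P} {a b : P}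
    (h : IsSurgery r r' a b) (hab : ¬ r a b) (hab' : r' a b) :
    surgery r r' a b (unit r) = unit r' := by
  ext l'
  simp only [surgery, unit, ofCoeff_single, Finsupp.single_apply, surgeryCoeff]
  simp only [hab, hab', not_true_eq_false, not_false_eq_true, and_true, if_true]
  by_cases C : (fun _ => Gen.plus) = l'
  · subst C
    simp [mulCoeff]
  · rw [if_neg C]
    split_ifs with C'
    · have : l' (Quotient.mk r' a) ≠ .plus := by
        intro k
        apply C
        funext c
        obtain ⟨q, rfl⟩ := Quotient.exists_rep c
        by_cases hqa : r' q a
        · rw [mk_congr hqa, k]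
        · rw [C' q (fun h' => hqa (h.le_of_rel hab' h'))
            (fun h' => hqa (r'.trans (h.le_of_rel hab' h') (r'.symm hab')))]
      rw [Gen.ne_plus.1 this]
      rfl
    · rfl

/-- This is `Δ u₊ = u₋ ⊗ u₊ + u₊ ⊗ u₋` written through the action, so that composites can be
evaluated by equivariance without handling labels. -/
theorem surgery_unit_of_split {P : Type} [Finite P] {r r' : Setoid P} {a b : P}
    (h : IsSurgery r r' a b) (hab : r a b) (hab' : ¬ r' a b) :
    surgery r r' a b (unit r) = dot r' a (unit r') + dot r' b (unit r') := by
  have hba' : ¬ r' b a := fun k => hab' (r'.symm k)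
  ext l'
  simp only [Finsupp.add_apply, surgery, unit, ofCoeff_single, surgeryCoeff,
    hab, hab', not_true_eq_false, not_false_eq_true, and_true, if_true, false_and, if_false,
    dot_single, Finsupp.single_apply]
  have key : ∀ c d : P, (c = a ∧ d = b) ∨ (c = b ∧ d = a) →
      ((Function.update (fun _ => Gen.plus) (Quotient.mk r' c) .minus = l') ↔
      ((∀ q : P, ¬ r q a → ¬ r q b → l' (Quotient.mk r' q) = .plus) ∧
        l' (Quotient.mk r' c) = .minus ∧ l' (Quotient.mk r' d) = .plus)) := by
    intro c d hcd
    have hdc : ¬ r' d c := by rcases hcd with ⟨rfl, rfl⟩ | ⟨rfl, rfl⟩ <;> assumption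
    constructor
    · rintro rfl
      refine ⟨fun q hqa hqb => ?_, by simp, ?_⟩
      · rw [update_mk, if_neg]
        rw [h.rel_iff hqa hqb]
        rcases hcd with ⟨rfl, rfl⟩ | ⟨rfl, rfl⟩ <;> assumption
      · rw [update_mk, if_neg hdc]
    · rintro ⟨h1, h2, h3⟩
      funext x
      obtain ⟨q, rfl⟩ := Quotient.exists_rep x
      rw [update_mk]
      split_ifs with hq
      · rw [mk_congr hq, h2]
      · by_cases hqd : r' q d
        · rw [mk_congr hqd, h3]
        · have hq' : ¬ r' q a ∧ ¬ r' q b := by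
            rcases hcd with ⟨rfl, rfl⟩ | ⟨rfl, rfl⟩ <;> exact ⟨by assumption, by assumption⟩
          rw [h1 q (fun k => hq'.1 ((h.symm.rel_iff hq'.1 hq'.2).1 k))
            (fun k => hq'.2 ((h.symm.rel_iff hq'.1 hq'.2).1 k))]
  rw [if_congr (key a b (by simp)) rfl rfl, if_congr (key b a (by simp)) rfl rfl]
  by_cases C : ∀ q : P, ¬ r q a → ¬ r q b → l' (Quotient.mk r' q) = .plus
  · rw [if_pos C]
    rw [if_congr (and_iff_right C) rfl rfl, if_congr (and_iff_right C) rfl rfl]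
    cases l' (Quotient.mk r' a) <;> cases l' (Quotient.mk r' b) <;> simp [comulCoeff]
  · rw [if_neg C, if_neg (fun k => C k.1), if_neg (fun k => C k.1), add_zero]

/-- Two surgeries on disjoint pairs of arcs induce commuting maps, provided that each of the four
steps merges two circles or splits a circle. -/
theorem surgery_comm {P : Type} [Finite P] {r₀₀ r₁₀ r₀₁ r₁₁ : Setoid P} {a b c d : P}
    (h₁ : IsSurgery r₀₀ r₁₀ a b) (h₂ : IsSurgery r₀₁ r₁₁ a b)
    (h₃ : IsSurgery r₀₀ r₀₁ c d) (h₄ : IsSurgery r₁₀ r₁₁ c d)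
    (k₁ : ¬ (r₀₀ a b ↔ r₁₀ a b)) (k₂ : ¬ (r₀₁ a b ↔ r₁₁ a b))
    (k₃ : ¬ (r₀₀ c d ↔ r₀₁ c d)) (k₄ : ¬ (r₁₀ c d ↔ r₁₁ c d)) (x : TensorPower r₀₀) :
    surgery r₀₁ r₁₁ a b (surgery r₀₀ r₀₁ c d x) =
      surgery r₁₀ r₁₁ c d (surgery r₀₀ r₁₀ a b x) := by
  suffices H : surgery r₀₁ r₁₁ a b ∘ₗ surgery r₀₀ r₀₁ c d =
      surgery r₁₀ r₁₁ c d ∘ₗ surgery r₀₀ r₁₀ a b from LinearMap.congr_fun H x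
  refine linearMap_ext_unit (dot r₁₁) (fun p x => ?_) (fun p x => ?_) ?_
  · simp [surgery_dot h₃, surgery_dot h₂]
  · simp [surgery_dot h₁, surgery_dot h₄]
  simp only [LinearMap.comp_apply]
  have merge : ∀ {r r' : Setoid P} {p q : P}, IsSurgery r r' p q → ¬ (r p q ↔ r' p q) →
      ¬ r p q → r ≤ r' := fun h k e => h.le_of_rel (by tauto)
  have split : ∀ {r r' : Setoid P} {p q : P}, IsSurgery r r' p q → r p q → r' ≤ r :=
    fun h e => h.symm.le_of_rel e
  -- Needed when the two routes use different pairs of points to express the same element: both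
  -- split and then merge, or both merge and then split.
  have congr : (r₁₁ a c ∧ r₁₁ b d) ∨ (r₁₁ a d ∧ r₁₁ b c) →
      dot r₁₁ a (unit r₁₁) + dot r₁₁ b (unit r₁₁) =
        dot r₁₁ c (unit r₁₁) + dot r₁₁ d (unit r₁₁) := by
    rintro (⟨h, h'⟩ | ⟨h, h'⟩)
    · rw [dot_congr h, dot_congr h']
    · rw [dot_congr h, dot_congr h', add_comm]
  have m₁ := merge h₁ k₁
  have m₂ := merge h₂ k₂
  have m₃ := merge h₃ k₃
  have m₄ := merge h₄ k₄
  have s₁ := split h₁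
  have s₂ := split h₂
  have s₃ := split h₃
  have s₄ := split h₄
  -- These four facts decide which steps are merges and which are splits. Ten of the sixteen
  -- patterns contradict that merges coarsen and splits refine; in the other six both routes are
  -- evaluated on `u₊ ⊗ ⋯ ⊗ u₊`.
  by_cases e₁ : r₀₀ a b <;> by_cases e₂ : r₀₁ a b <;> by_cases e₃ : r₀₀ c d <;>
    by_cases e₄ : r₁₀ c d <;>
    simp only [e₁, e₂, e₃, e₄, true_iff, false_iff, not_not, forall_const, not_true_eq_false,
      not_false_eq_true, IsEmpty.forall_iff] at k₁ k₂ k₃ k₄ m₁ m₂ m₃ m₄ s₁ s₂ s₃ s₄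
  · simp only [surgery_unit_of_split h₁ e₁ k₁, surgery_unit_of_split h₂ e₂ k₂,
      surgery_unit_of_split h₃ e₃ k₃, surgery_unit_of_split h₄ e₄ k₄, map_add, surgery_dot h₂,
      surgery_dot h₄, dot_comm r₁₁ c, dot_comm r₁₁ d]
    abel
  · exact absurd (s₂ k₄) k₃
  · exact absurd (s₁ e₄) e₃
  · simp only [surgery_unit_of_split h₁ e₁ k₁, surgery_unit_of_split h₂ e₂ k₂,
      surgery_unit_of_merge h₃ e₃ k₃, surgery_unit_of_merge h₄ e₄ k₄, map_add, surgery_dot h₄]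
  · exact absurd (s₄ k₂) k₁
  · simp only [surgery_unit_of_split h₁ e₁ k₁, surgery_unit_of_merge h₂ e₂ k₂,
      surgery_unit_of_split h₃ e₃ k₃, surgery_unit_of_merge h₄ e₄ k₄, map_add, surgery_dot h₂,
      surgery_dot h₄]
    refine (congr ?_).symm
    -- The points `c` and `d` share a circle at first but not after the split at `a`, `b`. So one of
    -- them goes with `a` and the other with `b`.
    rcases h₁.le e₃ with k | ⟨k, k'⟩ | ⟨k, k'⟩
    · exact absurd k e₄
    · exact Or.inl ⟨r₁₁.symm (m₄ k), m₄ k'⟩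
    · exact Or.inr ⟨m₄ k', r₁₁.symm (m₄ k)⟩
  · exact absurd (s₁ e₄) e₃
  · exact absurd (m₃ e₁) e₂
  · exact absurd (s₃ e₂) e₁
  · exact absurd (m₁ e₃) e₄
  · simp only [surgery_unit_of_merge h₁ e₁ k₁, surgery_unit_of_split h₂ e₂ k₂,
      surgery_unit_of_merge h₃ e₃ k₃, surgery_unit_of_split h₄ e₄ k₄]
    refine congr ?_
    rcases h₄.le k₁ with k | ⟨k, k'⟩ | ⟨k, k'⟩
    · exact absurd k k₂
    · exact Or.inl ⟨k, r₁₁.symm k'⟩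
    · exact Or.inr ⟨k, r₁₁.symm k'⟩
  · exact absurd (m₄ k₁) k₂
  · simp only [surgery_unit_of_merge h₁ e₁ k₁, surgery_unit_of_merge h₂ e₂ k₂,
      surgery_unit_of_split h₃ e₃ k₃, surgery_unit_of_split h₄ e₄ k₄, map_add, surgery_dot h₂]
  · exact absurd (m₁ e₃) e₄
  · exact absurd (m₂ k₃) k₄
  · simp only [surgery_unit_of_merge h₁ e₁ k₁, surgery_unit_of_merge h₂ e₂ k₂,
      surgery_unit_of_merge h₃ e₃ k₃, surgery_unit_of_merge h₄ e₄ k₄]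

/-! ## The cube of resolutions -/

namespace Diagram

variable {n : ℕ} (D : Diagram n)

theorem res_of_arc {D : Diagram n} {v : Fin n → Bool} {x y : D.Pt} (h : D.Arc v x y) :
    D.res v x y := Relation.EqvGen.rel _ _ h

theorem res_le {D : Diagram n} {v : Fin n → Bool} {s : Setoid D.Pt}
    (h : ∀ x y, D.Arc v x y → s x y) : D.res v ≤ s := Setoid.eqvGen_le h

/-- Changing the resolution of a crossing is a surgery. -/
theorem isSurgery_cross {v : Fin n → Bool} {c : Fin n} (hc : v c = false) :
    IsSurgery (D.res v) (D.res (Function.update v c true)) (D.cross c 0) (D.cross c 2) := by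
  set v' := Function.update v c true with hv'
  have hc' : v' c = true := by simp [hv']
  have hne : ∀ c', c' ≠ c → v' c' = v c' := fun c' h => by simp [hv', h]
  -- All arcs away from `c` are common to both resolutions, and once the ends `0` and `2` are joined
  -- all four ends of `c` lie in one class on either side.
  constructor
  · refine res_le fun x y hxy => ?_
    cases hxy with
    | joint j => exact Or.inl (res_of_arc (.joint j))
    | zero₁ c' h =>
      by_cases e : c' = c
      · subst e
        exact Or.inr (Or.inl ⟨(D.res v').refl _, (D.res v').symm (res_of_arc (.one₂ c' hc'))⟩)
      · exact Or.inl (res_of_arc (.zero₁ c' (by rw [hne _ e, h])))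
    | zero₂ c' h =>
      by_cases e : c' = c
      · subst e
        exact Or.inr (Or.inr ⟨(D.res v').refl _, res_of_arc (.one₁ c' hc')⟩)
      · exact Or.inl (res_of_arc (.zero₂ c' (by rw [hne _ e, h])))
    | one₁ c' h =>
      have e : c' ≠ c := by rintro rfl; simp [hc] at h
      exact Or.inl (res_of_arc (.one₁ c' (by rw [hne _ e, h])))
    | one₂ c' h =>
      have e : c' ≠ c := by rintro rfl; simp [hc] at h
      exact Or.inl (res_of_arc (.one₂ c' (by rw [hne _ e, h])))
  · refine res_le fun x y hxy => ?_
    cases hxy with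
    | joint j => exact Or.inl (res_of_arc (.joint j))
    | one₁ c' h =>
      by_cases e : c' = c
      · subst e
        exact Or.inr (Or.inl ⟨(D.res v).refl _, res_of_arc (.zero₂ c' hc)⟩)
      · exact Or.inl (res_of_arc (.one₁ c' (by rw [← hne _ e, h])))
    | one₂ c' h =>
      by_cases e : c' = c
      · subst e
        exact (glue (D.res v) _ _).symm
          (Or.inr (Or.inr ⟨(D.res v).refl _, res_of_arc (.zero₁ c' hc)⟩))
      · exact Or.inl (res_of_arc (.one₂ c' (by rw [← hne _ e, h])))
    | zero₁ c' h =>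
      have e : c' ≠ c := by rintro rfl; simp [hc'] at h
      exact Or.inl (res_of_arc (.zero₁ c' (by rw [← hne _ e, h])))
    | zero₂ c' h =>
      have e : c' ≠ c := by rintro rfl; simp [hc'] at h
      exact Or.inl (res_of_arc (.zero₂ c' (by rw [← hne _ e, h])))

/-- The circles of a resolution after a handle attachment, as a partition of the points of `D`. -/
def handleRes (e f : D.Joint) (v : Fin n → Bool) : Setoid D.Pt := (D.handle e f).res v

theorem arc_handle_of_arc {D : Diagram n} {e f : D.Joint} {v : Fin n → Bool} {x y : D.Pt}
    (h : D.Arc v x y) : (∃ j, x = D.src j ∧ y = D.tgt j) ∨ (D.handle e f).Arc v x y := by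
  cases h with
  | joint j => exact Or.inl ⟨j, rfl, rfl⟩
  | zero₁ c h => exact Or.inr (.zero₁ (D := D.handle e f) c h)
  | zero₂ c h => exact Or.inr (.zero₂ (D := D.handle e f) c h)
  | one₁ c h => exact Or.inr (.one₁ (D := D.handle e f) c h)
  | one₂ c h => exact Or.inr (.one₂ (D := D.handle e f) c h)

/-- Exchanging two targets is an involution, so one half of the surgery relation for handles yields
the other half. -/
theorem handle_handle (e f : D.Joint) : (D.handle e f).handle e f = D := by
  have : (fun j => D.tgt (Equiv.swap e f (Equiv.swap e f j))) = D.tgt :=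
    funext fun j => congrArg D.tgt (Equiv.congr_fun (Equiv.swap_swap e f) j)
  unfold handle
  simp only [this]

/-- A degenerate handle does nothing. Statements about the diagram with a handle therefore cover the
original diagram as well. -/
theorem handle_self (e : D.Joint) : D.handle e e = D := by
  have : (fun j => D.tgt (Equiv.swap e e j)) = D.tgt :=
    funext fun j => congrArg D.tgt (by rw [Equiv.swap_self]; rfl)
  unfold handle
  simp only [this]

/-- A handle attachment is a surgery. -/
theorem isSurgery_handle (e f : D.Joint) (v : Fin n → Bool) :
    IsSurgery (D.res v) (D.handleRes e f v) (D.src e) (D.src f) := by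
  have key : ∀ D : Diagram n, ∀ e f : D.Joint,
      D.res v ≤ glue (D.handleRes e f v) (D.src e) (D.src f) := by
    intro D e f
    have hj : ∀ j, D.handleRes e f v (D.src j) (D.tgt (Equiv.swap e f j)) := fun j =>
      res_of_arc (.joint (D := D.handle e f) (v := v) j)
    have he : D.handleRes e f v (D.src e) (D.tgt f) := by simpa using hj e
    have hf : D.handleRes e f v (D.src f) (D.tgt e) := by simpa using hj f
    refine res_le fun x y hxy => ?_
    rcases arc_handle_of_arc (e := e) (f := f) hxy with ⟨j, rfl, rfl⟩ | h
    · by_cases h1 : j = e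
      · subst h1
        exact Or.inr (Or.inl ⟨(D.handleRes _ f v).refl _, hf⟩)
      · by_cases h2 : j = f
        · subst h2
          exact Or.inr (Or.inr ⟨(D.handleRes e _ v).refl _, he⟩)
        · refine Or.inl ?_
          simpa [Equiv.swap_apply_of_ne_of_ne h1 h2] using hj j
    · exact Or.inl (res_of_arc h)
  refine ⟨key D e f, ?_⟩
  have h := key (D.handle e f) e f
  have h' : (D.handle e f).handleRes e f v = D.res v := by
    have : ∀ D', D' = D → HEq (D'.res v) (D.res v) := by rintro _ rfl; rfl
    exact eq_of_heq (this _ (D.handle_handle e f))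
  intro x y hxy
  have := h hxy
  rwa [h'] at this

/-- The summand of the Khovanov complex at a vertex of the cube. -/
def block (v : Fin n → Bool) : TensorPower (D.res v) →ₗ[ℤ] D.CKh :=
  Finsupp.lmapDomain ℤ ℤ (Sigma.mk (β := fun v => D.Circle v → Gen) v)

theorem block_single (v : Fin n → Bool) (l : D.Circle v → Gen) :
    D.block v (Finsupp.single l 1) = Finsupp.single ⟨v, l⟩ 1 := by
  simp [block]

theorem block_apply (v : Fin n → Bool) (x : TensorPower (D.res v)) (l : D.Circle v → Gen) :
    D.block v x ⟨v, l⟩ = x l :=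
  Finsupp.mapDomain_apply sigma_mk_injective _ _

theorem block_apply_ne {v : Fin n → Bool} (x : TensorPower (D.res v)) {s : D.State}
    (h : s.1 ≠ v) : D.block v x s = 0 := by
  refine Finsupp.mapDomain_of_notMem_range _ _ ?_
  rintro ⟨l, rfl⟩
  exact h rfl

variable {D}

theorem linearMap_ext_block {M : Type} [AddCommGroup M] {F G : D.CKh →ₗ[ℤ] M}
    (h : ∀ v x, F (D.block v x) = G (D.block v x)) : F = G := by
  refine Finsupp.lhom_ext' fun s => LinearMap.ext_ring ?_
  obtain ⟨v, l⟩ := s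
  have := h v (Finsupp.single l 1)
  rwa [block_single] at this

theorem linearMap_ext_single {M : Type} [AddCommGroup M] {P : Type} {r : Setoid P}
    {F G : TensorPower r →ₗ[ℤ] M}
    (h : ∀ l, F (Finsupp.single l 1) = G (Finsupp.single l 1)) (x) : F x = G x := by
  have : F = G := Finsupp.lhom_ext' fun l => LinearMap.ext_ring (h l)
  rw [this]

variable (D)

/-- The map along the edge of the cube at the vertex `v` that changes the crossing `c`. -/
def edge (v : Fin n → Bool) (c : Fin n) :
    TensorPower (D.res v) →ₗ[ℤ] TensorPower (D.res (Function.update v c true)) :=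
  surgery _ _ (D.cross c 0) (D.cross c 2)

theorem d_block (v : Fin n → Bool) (x : TensorPower (D.res v)) :
    D.d (D.block v x) = ∑ c : Fin n, if v c = false then
      ((-1 : ℤ) ^ edgeExp v c) • D.block (Function.update v c true) (D.edge v c x) else 0 := by
  suffices h : D.d ∘ₗ D.block v = ∑ c : Fin n, if v c = false then
      ((-1 : ℤ) ^ edgeExp v c) • D.block (Function.update v c true) ∘ₗ D.edge v c else 0 by
    have := LinearMap.congr_fun h x
    simp only [LinearMap.comp_apply, LinearMap.sum_apply] at this
    rw [this]
    refine Finset.sum_congr rfl fun c _ => ?_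
    split_ifs <;> rfl
  refine Finsupp.lhom_ext' fun l => LinearMap.ext_ring ?_
  ext t
  simp only [LinearMap.comp_apply, Finsupp.lsingle_apply, block_single, d, ofCoeff_single, dCoeff,
    LinearMap.sum_apply, Finsupp.finsetSum_apply]
  refine Finset.sum_congr rfl fun c _ => ?_
  obtain ⟨v', l'⟩ := t
  by_cases hc : v c = false
  · rw [if_pos hc, LinearMap.smul_apply, Finsupp.smul_apply, LinearMap.comp_apply]
    by_cases hv : v' = Function.update v c true
    · subst hv
      rw [if_pos ⟨hc, rfl⟩, block_apply, edge, surgery, ofCoeff_single, smul_eq_mul]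
    · rw [if_neg (fun h => hv h.2), block_apply_ne D _ hv, smul_zero]
  · rw [if_neg hc, if_neg (fun h => hc h.1)]
    rfl

/-- The summand of the Khovanov complex of the diagram after a handle attachment. -/
def handleBlock (e f : D.Joint) (v : Fin n → Bool) :
    TensorPower (D.handleRes e f v) →ₗ[ℤ] (D.handle e f).CKh :=
  (D.handle e f).block v

theorem handleMap_block (e f : D.Joint) (v : Fin n → Bool) (x : TensorPower (D.res v)) :
    D.handleMap e f (D.block v x) = D.handleBlock e f v
      (surgery (D.res v) (D.handleRes e f v) (D.src e) (D.src f) x) := by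
  refine linearMap_ext_single (F := D.handleMap e f ∘ₗ D.block v)
    (G := D.handleBlock e f v ∘ₗ
      surgery (D.res v) (D.handleRes e f v) (D.src e) (D.src f)) (fun l => ?_) x
  ext t
  obtain ⟨v', l'⟩ := t
  rw [LinearMap.comp_apply, LinearMap.comp_apply, block_single, handleMap, ofCoeff_single]
  by_cases hv : v' = v
  · subst hv
    rw [dif_pos rfl]
    exact ((block_apply (D.handle e f) v' _ l').trans (ofCoeff_single _ _ _)).symm
  · rw [dif_neg hv]
    exact (block_apply_ne (D.handle e f) _ hv).symm

/-- A handle attachment induces a chain map if each of the surgeries in the cube of `D` and in the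
cube of the new diagram merges two circles or splits a circle. -/
theorem isChainMap_handleMap (e f : D.Joint)
    (hD : ∀ v c, v c = false → ¬ (D.res v (D.cross c 0) (D.cross c 2) ↔
      D.res (Function.update v c true) (D.cross c 0) (D.cross c 2)))
    (hD' : ∀ v c, v c = false → ¬ (D.handleRes e f v (D.cross c 0) (D.cross c 2) ↔
      D.handleRes e f (Function.update v c true) (D.cross c 0) (D.cross c 2)))
    (hh : ∀ v, ¬ (D.res v (D.src e) (D.src f) ↔ D.handleRes e f v (D.src e) (D.src f))) :
    IsChainMap (D.handleMap e f) := by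
  intro x
  suffices H : D.handleMap e f ∘ₗ D.d = (D.handle e f).d ∘ₗ D.handleMap e f from
    LinearMap.congr_fun H x
  refine linearMap_ext_block fun v x => ?_
  rw [LinearMap.comp_apply, LinearMap.comp_apply, d_block, handleMap_block, map_sum]
  refine Eq.trans ?_ ((D.handle e f).d_block v _).symm
  refine Finset.sum_congr rfl fun c _ => ?_
  by_cases hc : v c = false
  · rw [if_pos hc, if_pos hc, map_smul, handleMap_block]
    refine congrArg (fun y => _ • D.handleBlock e f _ y) ?_
    -- The handle does not move the vertex of the cube, so the edge signs agree and only the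
    -- unsigned square of surgeries must commute.
    exact surgery_comm (D.isSurgery_handle e f v) (D.isSurgery_handle e f _)
      (D.isSurgery_cross hc) ((D.handle e f).isSurgery_cross hc) (hh v) (hh _) (hD v c hc)
      (hD' v c hc) x
  · rw [if_neg hc, if_neg hc, map_zero]

end Diagram

/-! ## Cycles of a permutation and transpositions -/

theorem mul_swap_apply_of_ne {P : Type} {π : Equiv.Perm P} {a b x : P} (ha : x ≠ a) (hb : x ≠ b) :
    (π * Equiv.swap a b) x = π x := by
  rw [Equiv.Perm.mul_apply, Equiv.swap_apply_of_ne_of_ne ha hb]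

section

variable {P : Type} [Finite P] {π : Equiv.Perm P} {a b : P}

/-- With `N` the length of the cycle of `b`, the new permutation takes `a` to `π b` and then follows
that cycle, which avoids `a`, until it reaches `π ^ N b = b`. -/
theorem sameCycle_mul_swap_of_not (h : ¬ π.SameCycle a b) :
    (π * Equiv.swap a b).SameCycle a b := by
  have hex : ∃ N, 0 < N ∧ (π ^ N) b = b :=
    ⟨orderOf π, orderOf_pos π, by rw [pow_orderOf_eq_one]; rfl⟩
  have hN := Nat.find_spec hex
  set N := Nat.find hex with hN'
  have key : ∀ i, i < N → ((π * Equiv.swap a b) ^ (i + 1)) a = (π ^ (i + 1)) b := by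
    intro i
    induction i with
    | zero => intro _; simp
    | succ i ih =>
      intro hi
      rw [pow_succ', Equiv.Perm.mul_apply, ih (by omega), mul_swap_apply_of_ne, pow_succ' π (i + 1),
        Equiv.Perm.mul_apply]
      · intro e
        exact h (Equiv.Perm.SameCycle.symm ⟨(i + 1 : ℕ), by rw [zpow_natCast]; exact e⟩)
      · intro e
        exact Nat.find_min hex hi ⟨by omega, e⟩
  obtain ⟨M, hM⟩ : ∃ M, N = M + 1 := ⟨N - 1, by omega⟩
  refine ⟨N, ?_⟩
  rw [zpow_natCast, hM, key M (by omega), ← hM, hN.2]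

/-- Let `k` be minimal with `π ^ k a = b`. The new permutation runs `b, π a, π² a, …, π ^ k a = b`:
this closes up after `k` steps and never meets `a`. -/
theorem not_sameCycle_mul_swap (hab : a ≠ b) (h : π.SameCycle a b) :
    ¬ (π * Equiv.swap a b).SameCycle a b := by
  have hex := h.exists_nat_pow_eq
  have hk := Nat.find_spec hex
  have hmin : ∀ i < Nat.find hex, (π ^ i) a ≠ b := fun i => Nat.find_min hex
  set k := Nat.find hex
  have hk0 : 0 < k := by
    rcases Nat.eq_zero_or_pos k with h0 | h0
    · rw [h0] at hk
      exact absurd hk hab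
    · exact h0
  have hne : ∀ i, 0 < i → i ≤ k → (π ^ i) a ≠ a := by
    intro i h0 hi e
    rcases hi.lt_or_eq with hi | rfl
    · refine hmin (k - i) (by omega) ?_
      have : (π ^ k) a = (π ^ (k - i)) ((π ^ i) a) := by
        rw [← Equiv.Perm.mul_apply, ← pow_add]
        congr 2
        omega
      rw [← hk, this, e]
    · exact hab (e.symm.trans hk)
  have key : ∀ i, i < k → ((π * Equiv.swap a b) ^ (i + 1)) b = (π ^ (i + 1)) a := by
    intro i
    induction i with
    | zero => intro _; simp
    | succ i ih =>
      intro hi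
      rw [pow_succ', Equiv.Perm.mul_apply, ih (by omega), mul_swap_apply_of_ne, pow_succ' π (i + 1),
        Equiv.Perm.mul_apply]
      · exact hne _ (by omega) (by omega)
      · exact hmin _ hi
  have hper : ((π * Equiv.swap a b) ^ k) b = b := by
    have := key (k - 1) (by omega)
    rw [Nat.sub_add_cancel hk0] at this
    rw [this, hk]
  intro hc
  obtain ⟨j, hj⟩ := hc.symm.exists_nat_pow_eq
  rw [← Nat.mod_add_div j k, pow_add, Equiv.Perm.mul_apply, pow_mul,
    Equiv.Perm.pow_apply_eq_self_of_apply_eq_self hper] at hj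
  rcases Nat.eq_zero_or_pos (j % k) with h0 | h0
  · rw [h0] at hj
    exact hab hj.symm
  · have := key (j % k - 1) (by have := Nat.mod_lt j hk0; omega)
    rw [Nat.sub_add_cancel h0, hj] at this
    exact hne _ h0 (Nat.mod_lt j hk0).le this.symm

/-- Multiplication by a transposition merges two cycles or splits a cycle. -/
theorem sameCycle_mul_swap (hab : a ≠ b) :
    ¬ (π.SameCycle a b ↔ (π * Equiv.swap a b).SameCycle a b) := by
  by_cases h : π.SameCycle a b
  · exact fun k => not_sameCycle_mul_swap hab h (k.1 h)
  · exact fun k => h (k.2 (sameCycle_mul_swap_of_not h))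

end

/-- Arcs are unoriented, so each is required to be a step of `π` in one direction or the other.
Conversely, steps of `π` must not leave a class. -/
theorem eqvGen_iff_sameCycle {P : Type} {π : Equiv.Perm P} {R : P → P → Prop} (h₁ : ∀ x y, R x y → π x = y ∨ π y = x)
    (h₂ : ∀ x, Relation.EqvGen.setoid R x (π x)) (x y : P) :
    Relation.EqvGen.setoid R x y ↔ π.SameCycle x y := by
  constructor
  · have : Relation.EqvGen.setoid R ≤ Equiv.Perm.SameCycle.setoid π := by
      refine Setoid.eqvGen_le fun x y h => ?_
      rcases h₁ x y h with rfl | rfl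
      · exact ⟨1, by simp⟩
      · exact Equiv.Perm.SameCycle.symm ⟨1, by simp⟩
    exact fun h => this h
  · rintro ⟨i, rfl⟩
    have hn : ∀ (n : ℕ) x, Relation.EqvGen.setoid R x ((π ^ n) x) := by
      intro n
      induction n with
      | zero => exact fun x => Setoid.refl' _ x
      | succ n ih =>
        intro x
        rw [pow_succ', Equiv.Perm.mul_apply]
        exact Setoid.trans' _ (ih x) (h₂ _)
    obtain ⟨n, rfl | rfl⟩ := i.eq_nat_or_neg
    · rw [zpow_natCast]
      exact hn n x
    · refine Setoid.symm' _ ?_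
      have := hn n ((π ^ (-(n : ℤ))) x)
      rwa [← zpow_natCast, ← Equiv.Perm.mul_apply, ← zpow_add, add_neg_cancel, zpow_zero] at this

/-! ## Orienting the resolutions of a closed braid -/

namespace BraidPt

theorem top_last {m n : ℕ} (j : Fin (m + 1)) : (top (Fin.last n) j : BraidPt m n) = base j := by
  simp [top]

theorem top_castSucc {m n : ℕ} (k : Fin n) (j : Fin (m + 1)) :
    (top k.castSucc j : BraidPt m n) = lo k j := by
  simp [top]

theorem bottom_zero {m n : ℕ} (j : Fin (m + 1)) : (bottom 0 j : BraidPt m n) = base j := rfl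

theorem bottom_succ {m n : ℕ} (k : Fin n) (j : Fin (m + 1)) :
    (bottom k.succ j : BraidPt m n) = hi k j := rfl

theorem bottom_inj {m n : ℕ} {t t' : Fin (n + 1)} {j j' : Fin (m + 1)}
    (h : (bottom t j : BraidPt m n) = bottom t' j') : t = t' ∧ j = j' := by
  refine ⟨?_, by simpa [string_bottom] using congrArg string h⟩
  induction t using Fin.cases <;> induction t' using Fin.cases <;>
    simp_all [bottom_zero, bottom_succ]

theorem lo_ne_bottom {m n : ℕ} (k : Fin n) (j : Fin (m + 1)) (t : Fin (n + 1))
    (j' : Fin (m + 1)) : lo k j ≠ bottom t j' := by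
  induction t using Fin.cases <;> simp [bottom_zero, bottom_succ]

end BraidPt

/-- The orientation of the strings that alternates between neighbouring strings: `true` is
upwards. -/
def up {m : ℕ} (ε : Bool) (j : Fin (m + 1)) : Bool := xor ε j.val.bodd

theorem up_not {m : ℕ} (ε : Bool) (j : Fin (m + 1)) : up (!ε) j = !up ε j := by
  simp [up]

theorem up_succ {m : ℕ} (ε : Bool) (i : Fin m) : up ε i.succ = !up ε i.castSucc := by
  simp [up]

section

variable {m n : ℕ} (w : BraidWord m n)

/-- The pairing of the strings at the `k`-th crossing in a resolution: the string `j` is connected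
through the crossing when it is fixed, and it turns back into its image otherwise. -/
def turn (v : Fin n → Bool) (k : Fin n) : Equiv.Perm (Fin (m + 1)) :=
  if v k = (w k).positive then Equiv.swap (w k).gen.castSucc (w k).gen.succ else 1

theorem turn_turn (v : Fin n → Bool) (k : Fin n) (j : Fin (m + 1)) :
    turn w v k (turn w v k j) = j := by
  unfold turn
  split_ifs <;> simp

/-- An arc that turns back joins neighbouring strings, and these have opposite directions. This is
why the alternating orientation is coherent on every resolution. -/
theorem up_turn (ε : Bool) (v : Fin n → Bool) (k : Fin n) (j : Fin (m + 1))
    (h : turn w v k j ≠ j) : up ε (turn w v k j) = !up ε j := by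
  unfold turn at h ⊢
  split_ifs at h ⊢
  · rcases Equiv.swap_apply_ne_self_iff.1 h with ⟨_, rfl | rfl⟩ <;> simp [up_succ]
  · simp at h

/-- The next point on the circles of a resolution, oriented so that the strings alternate. -/
def next (ε : Bool) (v : Fin n → Bool) : BraidPt m n → BraidPt m n
  | .base j => if up ε j then .top 0 j else .bottom (Fin.last n) j
  | .lo k j => if up ε j then if turn w v k j = j then .hi k j else .lo k (turn w v k j)
      else .bottom k.castSucc j
  | .hi k j => if up ε j then .top k.succ j
      else if turn w v k j = j then .lo k j else .hi k (turn w v k j)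

theorem next_bottom {ε : Bool} (v : Fin n → Bool) {j : Fin (m + 1)} (h : up ε j = true)
    (t : Fin (n + 1)) : next w ε v (.bottom t j) = .top t j := by
  induction t using Fin.cases <;> simp [BraidPt.bottom_zero, BraidPt.bottom_succ, next, h]

theorem next_top {ε : Bool} (v : Fin n → Bool) {j : Fin (m + 1)} (h : up ε j = false)
    (t : Fin (n + 1)) : next w ε v (.top t j) = .bottom t j := by
  induction t using Fin.lastCases <;> simp [BraidPt.top_last, BraidPt.top_castSucc, next, h]

/-- The points from which the oriented circles pass through the level of a crossing. -/
def IsLevelStart (ε : Bool) (x : BraidPt m n) : Prop :=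
  (∃ k j, x = .lo k j ∧ up ε j = true) ∨ (∃ k j, x = .hi k j ∧ up ε j = false)

theorem IsLevelStart.ne_bottom {ε : Bool} {x : BraidPt m n} (h : IsLevelStart ε x)
    {j : Fin (m + 1)} (hj : up ε j = true) (t : Fin (n + 1)) : x ≠ .bottom t j := by
  rcases h with ⟨k, i, rfl, hi⟩ | ⟨k, i, rfl, hi⟩
  · exact BraidPt.lo_ne_bottom _ _ _ _
  · intro e
    have := congrArg BraidPt.string e
    rw [BraidPt.string_bottom] at this
    change i = j at this
    subst this
    simp [hi] at hj

/-- These are the possible ways for an oriented circle to leave a point: up an arc between levels,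
down such an arc, or across a level. A base point is the bottom of the first arc on an upward string
and the top of the last arc on a downward one. -/
theorem exists_bottom_or_top (ε : Bool) (x : BraidPt m n) :
    (∃ t j, x = .bottom t j ∧ up ε j = true) ∨ (∃ t j, x = .top t j ∧ up ε j = false) ∨
      IsLevelStart ε x := by
  cases x with
  | base j =>
    by_cases h : up ε j = true
    · exact Or.inl ⟨0, j, rfl, h⟩
    · exact Or.inr (Or.inl ⟨Fin.last n, j, (BraidPt.top_last j).symm, by simpa using h⟩)
  | lo k j =>
    by_cases h : up ε j = true
    · exact Or.inr (Or.inr (Or.inl ⟨k, j, rfl, h⟩))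
    · exact Or.inr (Or.inl ⟨k.castSucc, j, (BraidPt.top_castSucc k j).symm, by simpa using h⟩)
  | hi k j =>
    by_cases h : up ε j = true
    · exact Or.inl ⟨k.succ, j, rfl, h⟩
    · exact Or.inr (Or.inr (Or.inr ⟨k, j, rfl, by simpa using h⟩))

/-- Replacing `ε` by its negation reverses every string, hence walks each circle backwards. -/
theorem next_next (ε : Bool) (v : Fin n → Bool) (x : BraidPt m n) :
    next w (!ε) v (next w ε v x) = x := by
  have up' : ∀ j : Fin (m + 1), up (!ε) j = !up ε j := up_not ε
  rcases exists_bottom_or_top ε x with ⟨t, j, rfl, h⟩ | ⟨t, j, rfl, h⟩ | ⟨k, j, rfl, h⟩ |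
    ⟨k, j, rfl, h⟩
  · rw [next_bottom w v h, next_top w v (by simp [up', h])]
  · rw [next_top w v h, next_bottom w v (by simp [up', h])]
  · by_cases ht : turn w v k j = j
    · simp [next, h, ht, up']
    · have := up_turn w ε v k j ht
      simp [next, h, ht, up', this, turn_turn, Ne.symm ht]
  · by_cases ht : turn w v k j = j
    · simp [next, h, ht, up']
    · have := up_turn w ε v k j ht
      simp [next, h, ht, up', this, turn_turn, Ne.symm ht]

/-- The permutation of the points whose cycles are the circles of a resolution. -/
def orient (ε : Bool) (v : Fin n → Bool) : Equiv.Perm (BraidPt m n) where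
  toFun := next w ε v
  invFun := next w (!ε) v
  left_inv := next_next w ε v
  right_inv x := by simpa using next_next w (!ε) v x

theorem orient_apply (ε : Bool) (v : Fin n → Bool) (x : BraidPt m n) :
    orient w ε v x = next w ε v x := rfl

theorem closure_cross_of_pos {k : Fin n} (h : (w k).positive = true) : (closure w).cross k =
    ![.lo k (w k).gen.succ, .hi k (w k).gen.succ, .hi k (w k).gen.castSucc,
      .lo k (w k).gen.castSucc] := if_pos h

theorem closure_cross_of_neg {k : Fin n} (h : (w k).positive = false) : (closure w).cross k =
    ![.lo k (w k).gen.castSucc, .lo k (w k).gen.succ, .hi k (w k).gen.succ,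
      .hi k (w k).gen.castSucc] := if_neg (by simp [h])

theorem turn_of_eq {v : Fin n → Bool} {k : Fin n} (h : v k = (w k).positive) :
    turn w v k = Equiv.swap (w k).gen.castSucc (w k).gen.succ := if_pos h

theorem turn_of_ne {v : Fin n → Bool} {k : Fin n} (h : v k ≠ (w k).positive) :
    turn w v k = 1 := if_neg h

theorem turn_of_not_mem (v : Fin n → Bool) {k : Fin n} {j : Fin (m + 1)}
    (h₁ : j ≠ (w k).gen.castSucc) (h₂ : j ≠ (w k).gen.succ) : turn w v k j = j := by
  unfold turn
  split_ifs
  · exact Equiv.swap_apply_of_ne_of_ne h₁ h₂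
  · rfl

/-- An oriented step at the level of a crossing. -/
def IsLevelStep (ε : Bool) (v : Fin n → Bool) (x y : BraidPt m n) : Prop :=
  IsLevelStart ε x ∧ next w ε v x = y

theorem isLevelStep_through (ε : Bool) {v : Fin n → Bool} {k : Fin n} {j : Fin (m + 1)}
    (h : turn w v k j = j) : IsLevelStep w ε v (.lo k j) (.hi k j) ∨
      IsLevelStep w ε v (.hi k j) (.lo k j) := by
  by_cases hj : up ε j = true
  · exact Or.inl ⟨Or.inl ⟨k, j, rfl, hj⟩, by simp [next, hj, h]⟩
  · rw [Bool.not_eq_true] at hj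
    exact Or.inr ⟨Or.inr ⟨k, j, rfl, hj⟩, by simp [next, hj, h]⟩

theorem isLevelStep_turn (ε : Bool) {v : Fin n → Bool} {k : Fin n} {j j' : Fin (m + 1)}
    (h : turn w v k j = j') (hne : j' ≠ j) :
    (IsLevelStep w ε v (.lo k j) (.lo k j') ∨ IsLevelStep w ε v (.lo k j') (.lo k j)) ∧
    (IsLevelStep w ε v (.hi k j) (.hi k j') ∨ IsLevelStep w ε v (.hi k j') (.hi k j)) := by
  subst h
  have hu := up_turn w ε v k j hne
  by_cases hj : up ε j = true
  · refine ⟨Or.inl ⟨Or.inl ⟨k, j, rfl, hj⟩, by simp [next, hj, hne]⟩,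
      Or.inr ⟨Or.inr ⟨k, _, rfl, by simp [hu, hj]⟩, ?_⟩⟩
    simp [next, hu, hj, turn_turn, hne.symm]
  · rw [Bool.not_eq_true] at hj
    refine ⟨Or.inr ⟨Or.inl ⟨k, _, rfl, by simp [hu, hj]⟩, ?_⟩,
      Or.inl ⟨Or.inr ⟨k, j, rfl, hj⟩, by simp [next, hj, hne]⟩⟩
    simp [next, hu, hj, turn_turn, hne.symm]

theorem castSucc_ne_succ (i : Fin m) : i.castSucc ≠ i.succ := by
  simp [Fin.ext_iff]

/-- The two arcs at a crossing pass straight through when the resolution is the oriented one (`0`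
for positive, `1` for negative), and turn back otherwise. -/
theorem isLevelStep_of_cross (ε : Bool) (v : Fin n → Bool) (k : Fin n) :
    (v k = false →
      (IsLevelStep w ε v ((closure w).cross k 0) ((closure w).cross k 1) ∨
        IsLevelStep w ε v ((closure w).cross k 1) ((closure w).cross k 0)) ∧
      (IsLevelStep w ε v ((closure w).cross k 2) ((closure w).cross k 3) ∨
        IsLevelStep w ε v ((closure w).cross k 3) ((closure w).cross k 2))) ∧
    (v k = true →
      (IsLevelStep w ε v ((closure w).cross k 0) ((closure w).cross k 3) ∨
        IsLevelStep w ε v ((closure w).cross k 3) ((closure w).cross k 0)) ∧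
      (IsLevelStep w ε v ((closure w).cross k 1) ((closure w).cross k 2) ∨
        IsLevelStep w ε v ((closure w).cross k 2) ((closure w).cross k 1))) := by
  have hcs : ∀ i : Fin m, i.castSucc ≠ i.succ := castSucc_ne_succ
  have through : v k ≠ (w k).positive → ∀ i, IsLevelStep w ε v (.lo k i) (.hi k i) ∨
      IsLevelStep w ε v (.hi k i) (.lo k i) := fun h i =>
    isLevelStep_through w ε (by rw [turn_of_ne w h]; rfl)
  have turned : v k = (w k).positive → _ := fun h =>
    isLevelStep_turn w ε (v := v) (k := k) (j := (w k).gen.castSucc) (j' := (w k).gen.succ)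
      (by rw [turn_of_eq w h, Equiv.swap_apply_left]) (hcs _).symm
  by_cases hp : (w k).positive = true
  · rw [closure_cross_of_pos w hp]
    refine ⟨fun h => ?_, fun h => ?_⟩
    · have := through (by simp [h, hp])
      exact ⟨this _, (this _).symm⟩
    · have := turned (by simp [h, hp])
      exact ⟨this.1.symm, this.2.symm⟩
  · rw [Bool.not_eq_true] at hp
    rw [closure_cross_of_neg w hp]
    refine ⟨fun h => ?_, fun h => ?_⟩
    · have := turned (by simp [h, hp])
      exact ⟨this.1, this.2.symm⟩
    · have := through (by simp [h, hp])
      exact ⟨this _, this _⟩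

/-! ### Handles on one string as transpositions of the oriented circles -/

/-- The circles of the diagram obtained from a closed braid by a handle that joins two arcs of
the string `j`. -/
def handleRes (t₁ t₂ : Fin (n + 1)) (j : Fin (m + 1)) (v : Fin n → Bool) :
    Setoid (BraidPt m n) :=
  (closure w).handleRes (.between t₁ j) (.between t₂ j) v

variable {w} in
theorem handleRes_of_cross {t₁ t₂ : Fin (n + 1)} {j : Fin (m + 1)} {v : Fin n → Bool} (k : Fin n) :
    (v k = false → handleRes w t₁ t₂ j v ((closure w).cross k 0) ((closure w).cross k 1) ∧
      handleRes w t₁ t₂ j v ((closure w).cross k 2) ((closure w).cross k 3)) ∧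
    (v k = true → handleRes w t₁ t₂ j v ((closure w).cross k 0) ((closure w).cross k 3) ∧
      handleRes w t₁ t₂ j v ((closure w).cross k 1) ((closure w).cross k 2)) := by
  refine ⟨fun h => ⟨?_, ?_⟩, fun h => ⟨?_, ?_⟩⟩
  · exact Diagram.res_of_arc (.zero₁ (D := (closure w).handle _ _) k h)
  · exact Diagram.res_of_arc (.zero₂ (D := (closure w).handle _ _) k h)
  · exact Diagram.res_of_arc (.one₁ (D := (closure w).handle _ _) k h)
  · exact Diagram.res_of_arc (.one₂ (D := (closure w).handle _ _) k h)

theorem handleRes_joint (t₁ t₂ : Fin (n + 1)) (j : Fin (m + 1)) (v : Fin n → Bool)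
    (i : BraidJoint w) : handleRes w t₁ t₂ j v ((closure w).src i)
      ((closure w).tgt (Equiv.swap (.between t₁ j) (.between t₂ j) i)) :=
  Diagram.res_of_arc (.joint (D := (closure w).handle _ _) i)

variable {w} in
theorem swap_between_through (t₁ t₂ : Fin (n + 1)) (j : Fin (m + 1)) (k : Fin n) (i : Fin (m + 1))
    (h₁ : i ≠ (w k).gen.castSucc) (h₂ : i ≠ (w k).gen.succ) :
    (Equiv.swap (.between t₁ j) (.between t₂ j) : Equiv.Perm (closure w).Joint)
      (BraidJoint.through k i h₁ h₂) = BraidJoint.through k i h₁ h₂ :=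
  Equiv.swap_apply_of_ne_of_ne
    (show (BraidJoint.through k i h₁ h₂ : BraidJoint w) ≠ .between t₁ j by simp)
    (show (BraidJoint.through k i h₁ h₂ : BraidJoint w) ≠ .between t₂ j by simp)

variable {w} in
theorem swap_between_left (t₁ t₂ : Fin (n + 1)) (j : Fin (m + 1)) :
    (Equiv.swap (.between t₁ j) (.between t₂ j) : Equiv.Perm (closure w).Joint)
      (BraidJoint.between t₁ j) = BraidJoint.between t₂ j :=
  Equiv.swap_apply_left _ _

variable {w} in
theorem swap_between_right (t₁ t₂ : Fin (n + 1)) (j : Fin (m + 1)) :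
    (Equiv.swap (.between t₁ j) (.between t₂ j) : Equiv.Perm (closure w).Joint)
      (BraidJoint.between t₂ j) = BraidJoint.between t₁ j :=
  Equiv.swap_apply_right _ _

variable {w} in
theorem swap_between_between {t₁ t₂ t : Fin (n + 1)} {i j : Fin (m + 1)}
    (h : (t ≠ t₁ ∧ t ≠ t₂) ∨ i ≠ j) :
    (Equiv.swap (.between t₁ j) (.between t₂ j) : Equiv.Perm (closure w).Joint)
      (BraidJoint.between t i) = BraidJoint.between t i := by
  refine Equiv.swap_apply_of_ne_of_ne ?_ ?_
  all_goals
    intro e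
    obtain ⟨rfl, rfl⟩ := BraidJoint.between.inj e
    tauto

theorem handleRes_through (t₁ t₂ : Fin (n + 1)) (j : Fin (m + 1)) {v : Fin n → Bool} {k : Fin n}
    {i : Fin (m + 1)} (h : turn w v k i = i) :
    handleRes w t₁ t₂ j v (.lo k i) (.hi k i) := by
  by_cases hi : i ≠ (w k).gen.castSucc ∧ i ≠ (w k).gen.succ
  · have := handleRes_joint w t₁ t₂ j v (.through k i hi.1 hi.2)
    rwa [swap_between_through] at this
  · have hv : v k ≠ (w k).positive := by
      intro hv
      rw [turn_of_eq w hv] at h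
      refine hi ⟨?_, ?_⟩
      · rintro rfl
        simp [Fin.ext_iff] at h
      · rintro rfl
        simp [Fin.ext_iff] at h
    have hc := handleRes_of_cross (w := w) (t₁ := t₁) (t₂ := t₂) (j := j) (v := v) k
    by_cases hp : (w k).positive = true
    · have hc := hc.1 (by simpa [hp] using hv)
      rw [closure_cross_of_pos w hp] at hc
      by_cases h1 : i = (w k).gen.castSucc
      · subst h1
        exact Setoid.symm' _ hc.2
      · have h2 : i = (w k).gen.succ := by tauto
        subst h2
        exact hc.1
    · rw [Bool.not_eq_true] at hp
      have hc := hc.2 (by simpa [hp] using hv)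
      rw [closure_cross_of_neg w hp] at hc
      by_cases h1 : i = (w k).gen.castSucc
      · subst h1
        exact hc.1
      · have h2 : i = (w k).gen.succ := by tauto
        subst h2
        exact hc.2

theorem handleRes_turn (t₁ t₂ : Fin (n + 1)) (j : Fin (m + 1)) {v : Fin n → Bool} {k : Fin n}
    {i : Fin (m + 1)} (h : turn w v k i ≠ i) :
    handleRes w t₁ t₂ j v (.lo k i) (.lo k (turn w v k i)) ∧
      handleRes w t₁ t₂ j v (.hi k i) (.hi k (turn w v k i)) := by
  have hv : v k = (w k).positive := by
    by_contra hv
    exact h (by rw [turn_of_ne w hv]; rfl)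
  rw [turn_of_eq w hv] at h ⊢
  have key : handleRes w t₁ t₂ j v (.lo k (w k).gen.castSucc) (.lo k (w k).gen.succ) ∧
      handleRes w t₁ t₂ j v (.hi k (w k).gen.castSucc) (.hi k (w k).gen.succ) := by
    have hc := handleRes_of_cross (w := w) (t₁ := t₁) (t₂ := t₂) (j := j) (v := v) k
    by_cases hp : (w k).positive = true
    · have hc := hc.2 (by rw [hv, hp])
      rw [closure_cross_of_pos w hp] at hc
      exact ⟨Setoid.symm' _ hc.1, Setoid.symm' _ hc.2⟩
    · rw [Bool.not_eq_true] at hp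
      have hc := hc.1 (by rw [hv, hp])
      rw [closure_cross_of_neg w hp] at hc
      exact ⟨hc.1, Setoid.symm' _ hc.2⟩
  rcases Equiv.swap_apply_ne_self_iff.1 h with ⟨_, rfl | rfl⟩
  · simpa using key
  · simpa using ⟨Setoid.symm' _ key.1, Setoid.symm' _ key.2⟩

/-- The permutation of the points whose cycles are the circles of a resolution of the diagram
obtained from a closed braid by a handle that joins two arcs of the string `j`. -/
def handlePerm (ε : Bool) (t₁ t₂ : Fin (n + 1)) (j : Fin (m + 1)) (v : Fin n → Bool) :
    Equiv.Perm (BraidPt m n) :=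
  orient w ε v * Equiv.swap (.bottom t₁ j) (.bottom t₂ j)

section

variable {ε : Bool} (t₁ t₂ : Fin (n + 1)) {j : Fin (m + 1)} (hj : up ε j = true) (v : Fin n → Bool)
include hj

theorem handlePerm_left : handlePerm w ε t₁ t₂ j v (.bottom t₁ j) = .top t₂ j := by
  simp [handlePerm, orient_apply, next_bottom w v hj]

theorem handlePerm_right : handlePerm w ε t₁ t₂ j v (.bottom t₂ j) = .top t₁ j := by
  simp [handlePerm, orient_apply, next_bottom w v hj]

theorem handlePerm_of_isLevelStart {x : BraidPt m n} (hx : IsLevelStart ε x) :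
    handlePerm w ε t₁ t₂ j v x = next w ε v x :=
  mul_swap_apply_of_ne (hx.ne_bottom hj t₁) (hx.ne_bottom hj t₂)

theorem handlePerm_top {t : Fin (n + 1)} {i : Fin (m + 1)} (hi : up ε i = false) :
    handlePerm w ε t₁ t₂ j v (.top t i) = .bottom t i := by
  rw [handlePerm, mul_swap_apply_of_ne, orient_apply, next_top w v hi]
  all_goals
    intro e
    have := congrArg BraidPt.string e
    rw [BraidPt.string_top, BraidPt.string_bottom] at this
    rw [this, hj] at hi
    simp at hi

end

theorem handlePerm_bottom {ε : Bool} {t₁ t₂ t : Fin (n + 1)} {i j : Fin (m + 1)}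
    (h : (t ≠ t₁ ∧ t ≠ t₂) ∨ i ≠ j) (v : Fin n → Bool) (hi : up ε i = true) :
    handlePerm w ε t₁ t₂ j v (.bottom t i) = .top t i := by
  rw [handlePerm, mul_swap_apply_of_ne, orient_apply, next_bottom w v hi]
  all_goals
    intro e
    have := BraidPt.bottom_inj e
    tauto

theorem handlePerm_joint {ε : Bool} (t₁ t₂ : Fin (n + 1)) {j : Fin (m + 1)} (hj : up ε j = true)
    (v : Fin n → Bool) (i : BraidJoint w) :
    handlePerm w ε t₁ t₂ j v ((closure w).src i) =
      (closure w).tgt (Equiv.swap (.between t₁ j) (.between t₂ j) i) ∨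
    handlePerm w ε t₁ t₂ j v ((closure w).tgt (Equiv.swap (.between t₁ j) (.between t₂ j) i)) =
      (closure w).src i := by
  cases i with
  | between t i =>
    by_cases h : (t ≠ t₁ ∧ t ≠ t₂) ∨ i ≠ j
    · rw [swap_between_between h]
      by_cases hi : up ε i = true
      · exact Or.inl (handlePerm_bottom w h v hi)
      · exact Or.inr (handlePerm_top w t₁ t₂ hj v (by simpa using hi))
    · have hij : i = j := by tauto
      subst hij
      by_cases h1 : t = t₁
      · subst h1
        rw [swap_between_left]
        exact Or.inl (handlePerm_left w t t₂ hj v)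
      · have h2 : t = t₂ := by tauto
        subst h2
        rw [swap_between_right]
        exact Or.inl (handlePerm_right w t₁ t hj v)
  | through k i h₁ h₂ =>
    rw [swap_between_through]
    exact (isLevelStep_through w ε (turn_of_not_mem w v h₁ h₂)).imp
      (fun h => (handlePerm_of_isLevelStart w t₁ t₂ hj v h.1).trans h.2)
      (fun h => (handlePerm_of_isLevelStart w t₁ t₂ hj v h.1).trans h.2)

theorem handleRes_handlePerm {ε : Bool} (t₁ t₂ : Fin (n + 1)) {j : Fin (m + 1)}
    (hj : up ε j = true) (v : Fin n → Bool) (x : BraidPt m n) :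
    handleRes w t₁ t₂ j v x (handlePerm w ε t₁ t₂ j v x) := by
  rcases exists_bottom_or_top ε x with ⟨t, i, rfl, h⟩ | ⟨t, i, rfl, h⟩ | hx
  · by_cases h' : (t ≠ t₁ ∧ t ≠ t₂) ∨ i ≠ j
    · rw [handlePerm_bottom w h' v h]
      have := handleRes_joint w t₁ t₂ j v (.between t i)
      rwa [swap_between_between h'] at this
    · have hij : i = j := by tauto
      subst hij
      have := handleRes_joint w t₁ t₂ i v (.between t i)
      by_cases h1 : t = t₁
      · subst h1
        rw [handlePerm_left w t t₂ hj]
        rwa [swap_between_left] at this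
      · have h2 : t = t₂ := by tauto
        subst h2
        rw [handlePerm_right w t₁ t hj]
        rwa [swap_between_right] at this
  · rw [handlePerm_top w t₁ t₂ hj v h]
    have := handleRes_joint w t₁ t₂ j v (.between t i)
    rw [swap_between_between (Or.inr (by rintro rfl; simp [hj] at h))] at this
    exact Setoid.symm' _ this
  · rw [handlePerm_of_isLevelStart w t₁ t₂ hj v hx]
    rcases hx with ⟨k, i, rfl, hi⟩ | ⟨k, i, rfl, hi⟩
    · by_cases ht : turn w v k i = i
      · simpa [next, hi, ht] using handleRes_through w t₁ t₂ j ht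
      · simpa [next, hi, ht] using (handleRes_turn w t₁ t₂ j ht).1
    · by_cases ht : turn w v k i = i
      · simpa [next, hi, ht] using Setoid.symm' _ (handleRes_through w t₁ t₂ j ht)
      · simpa [next, hi, ht] using (handleRes_turn w t₁ t₂ j ht).2

/-- With the string `j` directed upwards, exchanging the ends of its two arcs amounts to exchanging
the successors of their starting points. Taking `t₁ = t₂` describes the closed braid itself. -/
theorem handleRes_iff {ε : Bool} (t₁ t₂ : Fin (n + 1)) {j : Fin (m + 1)} (hj : up ε j = true)
    (v : Fin n → Bool) (x y : BraidPt m n) : handleRes w t₁ t₂ j v x y ↔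
      (handlePerm w ε t₁ t₂ j v).SameCycle x y := by
  have step : ∀ {x y}, IsLevelStep w ε v x y ∨ IsLevelStep w ε v y x →
      handlePerm w ε t₁ t₂ j v x = y ∨ handlePerm w ε t₁ t₂ j v y = x := fun h =>
    h.imp (fun h => (handlePerm_of_isLevelStart w t₁ t₂ hj v h.1).trans h.2)
      (fun h => (handlePerm_of_isLevelStart w t₁ t₂ hj v h.1).trans h.2)
  suffices key : ∀ x y : ((closure w).handle (.between t₁ j) (.between t₂ j)).Pt,
      ((closure w).handle (.between t₁ j) (.between t₂ j)).Arc v x y →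
        handlePerm w ε t₁ t₂ j v x = y ∨ handlePerm w ε t₁ t₂ j v y = x from
    eqvGen_iff_sameCycle key (handleRes_handlePerm w t₁ t₂ hj v) x y
  intro x y h
  cases h with
  | joint i => exact handlePerm_joint w t₁ t₂ hj v i
  | zero₁ k h => exact step ((isLevelStep_of_cross w ε v k).1 h).1
  | zero₂ k h => exact step ((isLevelStep_of_cross w ε v k).1 h).2
  | one₁ k h => exact step ((isLevelStep_of_cross w ε v k).2 h).1
  | one₂ k h => exact step ((isLevelStep_of_cross w ε v k).2 h).2

theorem handleRes_self (t : Fin (n + 1)) (j : Fin (m + 1)) (v : Fin n → Bool) :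
    handleRes w t t j v = (closure w).res v := by
  have h : (closure w).handle (.between t j) (.between t j) = closure w := (closure w).handle_self _
  have : ∀ D, D = closure w → HEq (D.res v) ((closure w).res v) := by rintro _ rfl; rfl
  exact eq_of_heq (this _ h)

/-! ### Crossing changes and handles merge or split circles -/

/-- Changing the resolution of a crossing multiplies the permutation by a transposition. -/
theorem orient_update {ε : Bool} {v : Fin n → Bool} {c : Fin n} (hc : v c = false)
    {i i' : Fin (m + 1)} (hi : up ε i = true) (hi' : up ε i' = false)
    (h : Equiv.swap (w c).gen.castSucc (w c).gen.succ i = i') :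
    orient w ε (Function.update v c true) =
      orient w ε v * Equiv.swap (.lo c i) (.hi c i') := by
  have hii : i ≠ i' := by rintro rfl; simp [hi] at hi'
  have h' : Equiv.swap (w c).gen.castSucc (w c).gen.succ i' = i := by rw [← h]; simp
  have hfix : ∀ j, j ≠ i → j ≠ i' →
      Equiv.swap (w c).gen.castSucc (w c).gen.succ j = j := by
    intro j h1 h2
    by_contra hj
    have hs : Equiv.swap (w c).gen.castSucc (w c).gen.succ i ≠ i := by rw [h]; exact hii.symm
    rcases Equiv.swap_apply_ne_self_iff.1 hj with ⟨_, rfl | rfl⟩ <;>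
      rcases Equiv.swap_apply_ne_self_iff.1 hs with ⟨_, rfl | rfl⟩ <;> simp_all
  have hne : ∀ k, k ≠ c → turn w (Function.update v c true) k = turn w v k := by
    intro k hk
    simp [turn, hk]
  have hturn : ∀ j, j ≠ i → j ≠ i' → ∀ v, turn w v c j = j := by
    intro j h1 h2 v
    unfold turn
    split_ifs
    · exact hfix j h1 h2
    · rfl
  have hboth : (turn w v c i = i ∧ turn w v c i' = i' ∧
      turn w (Function.update v c true) c i = i' ∧ turn w (Function.update v c true) c i' = i) ∨
      (turn w v c i = i' ∧ turn w v c i' = i ∧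
      turn w (Function.update v c true) c i = i ∧
        turn w (Function.update v c true) c i' = i') := by
    cases hp : (w c).positive <;> simp [turn, hc, hp, h, h']
  -- The oriented circles enter the crossing at `lo c i` on the upward string and at `hi c i'` on
  -- the downward one. Only these two points change their successors, and they exchange them.
  ext x
  rw [Equiv.Perm.mul_apply, orient_apply, orient_apply]
  cases x with
  | base j =>
    rw [Equiv.swap_apply_of_ne_of_ne (by simp) (by simp)]
    rfl
  | lo k j =>
    by_cases hk : k = c
    · subst hk
      by_cases hj : j = i
      · subst hj
        rw [Equiv.swap_apply_left]
        rcases hboth with ⟨h1, h2, h3, h4⟩ | ⟨h1, h2, h3, h4⟩ <;>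
          simp [next, hi, hi', h2, h3, hii, hii.symm]
      · rw [Equiv.swap_apply_of_ne_of_ne (by simp [hj]) (by simp)]
        by_cases hj' : j = i'
        · subst hj'
          simp [next, hi']
        · simp [next, hturn j hj hj']
    · rw [Equiv.swap_apply_of_ne_of_ne (by simp [hk]) (by simp)]
      simp [next, hne k hk]
  | hi k j =>
    by_cases hk : k = c
    · subst hk
      by_cases hj : j = i'
      · subst hj
        rw [Equiv.swap_apply_right]
        rcases hboth with ⟨h1, h2, h3, h4⟩ | ⟨h1, h2, h3, h4⟩ <;>
          simp [next, hi, hi', h1, h4, hii, hii.symm]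
      · rw [Equiv.swap_apply_of_ne_of_ne (by simp) (by simp [hj])]
        by_cases hj' : j = i
        · subst hj'
          simp [next, hi]
        · simp [next, hturn j hj' hj]
    · rw [Equiv.swap_apply_of_ne_of_ne (by simp) (by simp [hk])]
      simp [next, hne k hk]

/-- The four ends are joined in pairs, either straight through or turning back, so the two diagonals
of the crossing are connected or disconnected together. One may then use the diagonal whose ends are
the entry points for the chosen orientation. -/
theorem handleRes_cross_iff (t₁ t₂ : Fin (n + 1)) (j : Fin (m + 1)) (v : Fin n → Bool)
    {c : Fin n} {i i' : Fin (m + 1)}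
    (h : (i = (w c).gen.castSucc ∧ i' = (w c).gen.succ) ∨
      (i = (w c).gen.succ ∧ i' = (w c).gen.castSucc)) :
    handleRes w t₁ t₂ j v ((closure w).cross c 0) ((closure w).cross c 2) ↔
      handleRes w t₁ t₂ j v (.lo c i) (.hi c i') := by
  set r := handleRes w t₁ t₂ j v with hr
  have hs : ∀ x y : BraidPt m n, r x y → r y x := fun x y h => r.symm h
  have htr : ∀ x y z : BraidPt m n, r x y → r y z → r x z := fun x y z h h' => r.trans h h'
  have key : r (.lo c (w c).gen.castSucc) (.hi c (w c).gen.succ) ↔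
      r (.lo c (w c).gen.succ) (.hi c (w c).gen.castSucc) := by
    by_cases hv : v c = (w c).positive
    · have h0 : turn w v c (w c).gen.castSucc = (w c).gen.succ := by
        rw [turn_of_eq w hv, Equiv.swap_apply_left]
      have := handleRes_turn w t₁ t₂ j (v := v) (k := c) (i := (w c).gen.castSucc)
        (by rw [h0]; exact (castSucc_ne_succ _).symm)
      rw [h0] at this
      obtain ⟨h1, h2⟩ := this
      exact ⟨fun k => htr _ _ _ (hs _ _ h1) (htr _ _ _ k (hs _ _ h2)),
        fun k => htr _ _ _ h1 (htr _ _ _ k h2)⟩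
    · have h1 := handleRes_through w t₁ t₂ j (v := v) (k := c) (i := (w c).gen.castSucc)
        (by rw [turn_of_ne w hv]; rfl)
      have h2 := handleRes_through w t₁ t₂ j (v := v) (k := c) (i := (w c).gen.succ)
        (by rw [turn_of_ne w hv]; rfl)
      exact ⟨fun k => htr _ _ _ h2 (htr _ _ _ (hs _ _ k) h1),
        fun k => htr _ _ _ h1 (htr _ _ _ (hs _ _ k) h2)⟩
  have hcross : r ((closure w).cross c 0) ((closure w).cross c 2) ↔
      r (.lo c (w c).gen.castSucc) (.hi c (w c).gen.succ) := by
    by_cases hp : (w c).positive = true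
    · rw [closure_cross_of_pos w hp, key]
      rfl
    · rw [closure_cross_of_neg w (by simpa using hp)]
      rfl
  rcases h with ⟨rfl, rfl⟩ | ⟨rfl, rfl⟩
  · exact hcross
  · exact hcross.trans key

/-- Changing the resolution of a crossing merges two circles or splits a circle. -/
theorem handleRes_cross_not_iff (t₁ t₂ : Fin (n + 1)) (j : Fin (m + 1)) (v : Fin n → Bool)
    (c : Fin n) (hc : v c = false) :
    ¬ (handleRes w t₁ t₂ j v ((closure w).cross c 0) ((closure w).cross c 2) ↔
      handleRes w t₁ t₂ j (Function.update v c true) ((closure w).cross c 0)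
        ((closure w).cross c 2)) := by
  obtain ⟨ε, hj⟩ : ∃ ε, up ε j = true := by
    cases h : up false j
    · exact ⟨true, by rw [← Bool.not_false, up_not, h, Bool.not_false]⟩
    · exact ⟨false, h⟩
  obtain ⟨i, i', hi, hi', h⟩ : ∃ i i', up ε i = true ∧ up ε i' = false ∧
      ((i = (w c).gen.castSucc ∧ i' = (w c).gen.succ) ∨
      (i = (w c).gen.succ ∧ i' = (w c).gen.castSucc)) := by
    have hu := up_succ ε (w c).gen
    by_cases h : up ε (w c).gen.castSucc = true
    · exact ⟨_, _, h, by simp [hu, h], Or.inl ⟨rfl, rfl⟩⟩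
    · exact ⟨_, _, by simpa [hu] using h, by simpa using h, Or.inr ⟨rfl, rfl⟩⟩
  have hs : Equiv.swap (w c).gen.castSucc (w c).gen.succ i = i' := by
    rcases h with ⟨rfl, rfl⟩ | ⟨rfl, rfl⟩ <;> simp
  have hd : ∀ t, (BraidPt.hi c i' : BraidPt m n) ≠ .bottom t j := fun t =>
    IsLevelStart.ne_bottom (ε := ε) (Or.inr ⟨c, i', rfl, hi'⟩) hj t
  have hl : ∀ t, (BraidPt.lo c i : BraidPt m n) ≠ .bottom t j := fun t =>
    BraidPt.lo_ne_bottom _ _ _ _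
  -- Entry points of a crossing are never bottoms of arcs on the upward string `j`, so the
  -- transpositions of the crossing and of the handle have disjoint supports.
  have hcomm : Equiv.swap (BraidPt.lo c i : BraidPt m n) (.hi c i') *
      Equiv.swap (.bottom t₁ j) (.bottom t₂ j) =
      Equiv.swap (.bottom t₁ j) (.bottom t₂ j) * Equiv.swap (.lo c i) (.hi c i') := by
    ext x
    simp only [Equiv.Perm.mul_apply]
    by_cases h1 : x = .lo c i
    · subst h1
      rw [Equiv.swap_apply_left, Equiv.swap_apply_of_ne_of_ne (hl _) (hl _),
        Equiv.swap_apply_of_ne_of_ne (hd _) (hd _), Equiv.swap_apply_left]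
    · by_cases h2 : x = .hi c i'
      · subst h2
        rw [Equiv.swap_apply_right, Equiv.swap_apply_of_ne_of_ne (hl _) (hl _),
          Equiv.swap_apply_of_ne_of_ne (hd _) (hd _), Equiv.swap_apply_right]
      · rw [Equiv.swap_apply_of_ne_of_ne h1 h2]
        by_cases h3 : x = .bottom t₁ j
        · subst h3
          rw [Equiv.swap_apply_left,
            Equiv.swap_apply_of_ne_of_ne (hl _).symm (hd _).symm]
        · by_cases h4 : x = .bottom t₂ j
          · subst h4
            rw [Equiv.swap_apply_right,
              Equiv.swap_apply_of_ne_of_ne (hl _).symm (hd _).symm]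
          · rw [Equiv.swap_apply_of_ne_of_ne h3 h4, Equiv.swap_apply_of_ne_of_ne h1 h2]
  have hperm : handlePerm w ε t₁ t₂ j (Function.update v c true) =
      handlePerm w ε t₁ t₂ j v * Equiv.swap (.lo c i) (.hi c i') := by
    rw [handlePerm, handlePerm, orient_update w hc hi hi' hs, mul_assoc, hcomm, mul_assoc]
  rw [handleRes_cross_iff w t₁ t₂ j _ h, handleRes_cross_iff w t₁ t₂ j _ h,
    handleRes_iff w t₁ t₂ hj, handleRes_iff w t₁ t₂ hj, hperm]
  exact sameCycle_mul_swap (by simp)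

/-- A handle that joins two different arcs of a string merges two circles or splits a circle. -/
theorem handleRes_bottom_not_iff {t₁ t₂ : Fin (n + 1)} (ht : t₁ ≠ t₂) (j : Fin (m + 1))
    (v : Fin n → Bool) : ¬ ((closure w).res v (.bottom t₁ j) (.bottom t₂ j) ↔
      handleRes w t₁ t₂ j v (.bottom t₁ j) (.bottom t₂ j)) := by
  obtain ⟨ε, hj⟩ : ∃ ε, up ε j = true := by
    cases h : up false j
    · exact ⟨true, by rw [← Bool.not_false, up_not, h, Bool.not_false]⟩
    · exact ⟨false, h⟩
  have h₁ : (closure w).res v (.bottom t₁ j) (.bottom t₂ j) ↔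
      (orient w ε v).SameCycle (.bottom t₁ j) (.bottom t₂ j) := by
    have := handleRes_iff w t₁ t₁ hj v (.bottom t₁ j) (.bottom t₂ j)
    rwa [handleRes_self, handlePerm, Equiv.swap_self, ← Equiv.Perm.one_def, mul_one] at this
  refine fun h => sameCycle_mul_swap (π := orient w ε v)
    (fun h => ht (BraidPt.bottom_inj h).1) (h₁.symm.trans (h.trans ?_))
  exact handleRes_iff w t₁ t₂ hj v _ _

/-- A handle that joins two different arcs of a string induces a chain map. -/
theorem isChainMap_handleMap {t₁ t₂ : Fin (n + 1)} (ht : t₁ ≠ t₂) (j : Fin (m + 1)) :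
    IsChainMap ((closure w).handleMap (.between t₁ j) (.between t₂ j)) := by
  refine (closure w).isChainMap_handleMap _ _ (fun v c hc => ?_)
    (handleRes_cross_not_iff w t₁ t₂ j) (handleRes_bottom_not_iff w ht j)
  have := handleRes_cross_not_iff w t₁ t₁ j v c hc
  rwa [handleRes_self, handleRes_self] at this

theorem isChainMap_handlePart (w : BraidWord m (n + 1)) (k : Fin (n + 1)) (left : Bool) :
    IsChainMap (handlePart w k left) :=
  isChainMap_handleMap w (castSucc_ne_succ k) _

end

/-! ## Extending labellings along an injection of circles -/

section

variable {P P' : Type} (φ : P → P') (r : Setoid P) (r' : Setoid P')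

/-- The labelling by `l` of the classes that meet the image of `φ`, and by `u₊` of the others. -/
def extendLabel (l : Quotient r → Gen) : Quotient r' → Gen := fun y =>
  if h : ∃ p, Quotient.mk r' (φ p) = y then l (Quotient.mk r h.choose) else .plus

/-- The map `x ↦ x ⊗ u₊ ⊗ ⋯ ⊗ u₊` between tensor powers. -/
def incl : TensorPower r →ₗ[ℤ] TensorPower r' := Finsupp.lmapDomain ℤ ℤ (extendLabel φ r r')

variable {φ r r'}

theorem incl_single (l : Quotient r → Gen) :
    incl φ r r' (Finsupp.single l 1) = Finsupp.single (extendLabel φ r r' l) 1 := by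
  simp [incl]

theorem extendLabel_of_not {l : Quotient r → Gen} {y : P'} (h : ∀ p, ¬ r' (φ p) y) :
    extendLabel φ r r' l (Quotient.mk r' y) = .plus :=
  dif_neg fun ⟨p, hp⟩ => h p (Quotient.exact hp)

theorem incl_unit : incl φ r r' (unit r) = unit r' := by
  rw [unit, incl_single, unit]
  congr 1
  funext y
  simp [extendLabel]

variable (h : ∀ p p', r' (φ p) (φ p') ↔ r p p')
include h

theorem extendLabel_mk (l : Quotient r → Gen) (p : P) :
    extendLabel φ r r' l (Quotient.mk r' (φ p)) = l (Quotient.mk r p) := by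
  have hex : ∃ p', Quotient.mk r' (φ p') = Quotient.mk r' (φ p) := ⟨p, rfl⟩
  rw [extendLabel, dif_pos hex]
  exact congrArg l (mk_congr ((h _ _).1 (Quotient.exact hex.choose_spec)))

theorem extendLabel_update (l : Quotient r → Gen) (p : P) (g : Gen) :
    extendLabel φ r r' (Function.update l (Quotient.mk r p) g) =
      Function.update (extendLabel φ r r' l) (Quotient.mk r' (φ p)) g := by
  funext y
  obtain ⟨x, rfl⟩ := Quotient.exists_rep y
  by_cases hx : ∃ p', r' (φ p') x
  · obtain ⟨p', hp'⟩ := hx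
    rw [← mk_congr hp', extendLabel_mk h, update_mk, update_mk, extendLabel_mk h,
      if_congr (h p' p) rfl rfl]
  · have hx' : ∀ p', ¬ r' (φ p') x := fun p' k => hx ⟨p', k⟩
    rw [extendLabel_of_not hx', update_mk, extendLabel_of_not hx', if_neg]
    exact fun k => hx' p (r'.symm k)

theorem incl_dot (p : P) (x : TensorPower r) :
    incl φ r r' (dot r p x) = dot r' (φ p) (incl φ r r' x) := by
  refine Diagram.linearMap_ext_single (F := incl φ r r' ∘ₗ dot r p)
    (G := dot r' (φ p) ∘ₗ incl φ r r') (fun l => ?_) x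
  rw [LinearMap.comp_apply, LinearMap.comp_apply, incl_single, dot_single, dot_single,
    extendLabel_mk h]
  split_ifs
  · rw [incl_single, extendLabel_update h]
  · rw [map_zero]

omit h in
-- Since `φ` preserves and reflects the relations, the surgery is of the same type on both sides.
-- Both composites are equivariant, so it suffices to compare them on `u₊ ⊗ ⋯ ⊗ u₊`.
theorem incl_surgery [Finite P] [Finite P'] {r₀ r₁ : Setoid P} {r₀' r₁' : Setoid P'} {a b : P}
    (h₀ : ∀ p p', r₀' (φ p) (φ p') ↔ r₀ p p') (h₁ : ∀ p p', r₁' (φ p) (φ p') ↔ r₁ p p')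
    (hs : IsSurgery r₀ r₁ a b) (hs' : IsSurgery r₀' r₁' (φ a) (φ b)) (x : TensorPower r₀) :
    surgery r₀' r₁' (φ a) (φ b) (incl φ r₀ r₀' x) = incl φ r₁ r₁' (surgery r₀ r₁ a b x) := by
  suffices H : surgery r₀' r₁' (φ a) (φ b) ∘ₗ incl φ r₀ r₀' =
      incl φ r₁ r₁' ∘ₗ surgery r₀ r₁ a b from LinearMap.congr_fun H x
  refine linearMap_ext_unit (fun p => dot r₁' (φ p)) (fun p x => ?_) (fun p x => ?_) ?_
  · simp [incl_dot h₀, surgery_dot hs']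
  · simp [incl_dot h₁, surgery_dot hs]
  simp only [LinearMap.comp_apply, incl_unit]
  by_cases e : (r₀ a b ↔ r₁ a b)
  · have e' : r₀' (φ a) (φ b) ↔ r₁' (φ a) (φ b) := by rw [h₀, h₁, e]
    rw [surgery_eq_zero e, surgery_eq_zero e']
    simp
  · by_cases e₀ : r₀ a b
    · have e₁ : ¬ r₁ a b := by tauto
      rw [surgery_unit_of_split hs e₀ e₁,
        surgery_unit_of_split hs' ((h₀ _ _).2 e₀) (fun k => e₁ ((h₁ _ _).1 k)), map_add,
        incl_dot h₁, incl_dot h₁, incl_unit]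
    · have e₁ : r₁ a b := by tauto
      rw [surgery_unit_of_merge hs e₀ e₁,
        surgery_unit_of_merge hs' (fun k => e₀ ((h₀ _ _).1 k)) ((h₁ _ _).2 e₁), incl_unit]

end

/-! ## Vertices of the cube and signs -/

/-- The vertex of the cube with the coordinate `b` inserted at the position `k`. -/
def ins {n : ℕ} (k : Fin (n + 1)) (b : Bool) (u : Fin n → Bool) : Fin (n + 1) → Bool :=
  Fin.insertNth (α := fun _ => Bool) k b u

section

variable {n : ℕ} (k : Fin (n + 1))

theorem ins_same (b : Bool) (u : Fin n → Bool) : ins k b u k = b := by simp [ins]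

theorem ins_succAbove (b : Bool) (u : Fin n → Bool) (i : Fin n) :
    ins k b u (k.succAbove i) = u i := by simp [ins]

theorem eq_ins_iff {v : Fin (n + 1) → Bool} {b : Bool} {u : Fin n → Bool} :
    v = ins k b u ↔ v k = b ∧ ∀ i, v (k.succAbove i) = u i := by
  constructor
  · rintro rfl
    exact ⟨ins_same k b u, ins_succAbove k b u⟩
  · rintro ⟨h, h'⟩
    funext j
    induction j using Fin.succAboveCases k with
    | x => rw [h, ins_same]
    | p i => rw [h', ins_succAbove]

theorem update_ins (b : Bool) (u : Fin n → Bool) (i : Fin n) :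
    Function.update (ins k b u) (k.succAbove i) true = ins k b (Function.update u i true) := by
  rw [eq_ins_iff]
  refine ⟨?_, fun j => ?_⟩
  · rw [Function.update_of_ne (Fin.ne_succAbove k i), ins_same]
  · by_cases h : j = i
    · subst h
      simp
    · rw [Function.update_of_ne (by simpa using h), Function.update_of_ne h, ins_succAbove]

theorem update_ins_same (u : Fin n → Bool) :
    Function.update (ins k false u) k true = ins k true u := by
  rw [eq_ins_iff]
  refine ⟨by simp, fun j => ?_⟩
  rw [Function.update_of_ne (Fin.succAbove_ne k j), ins_succAbove]

theorem edgeExp_eq_sum {n : ℕ} (v : Fin n → Bool) (c : Fin n) :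
    edgeExp v c = ∑ j : Fin n, if j < c ∧ v j = true then 1 else 0 := by
  rw [edgeExp, Finset.card_filter]

theorem edgeExp_ins (b : Bool) (u : Fin n → Bool) (i : Fin n) :
    edgeExp (ins k b u) (k.succAbove i) =
      (if k < k.succAbove i ∧ b = true then 1 else 0) + edgeExp u i := by
  rw [edgeExp_eq_sum, edgeExp_eq_sum, Fin.sum_univ_succAbove _ k]
  simp [ins_same, ins_succAbove]

theorem edgeExp_ins_same (u : Fin n → Bool) : edgeExp (ins k false u) k =
    ∑ j : Fin n, if k.succAbove j < k ∧ u j = true then 1 else 0 := by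
  rw [edgeExp_eq_sum, Fin.sum_univ_succAbove _ k]
  simp [ins_succAbove]

theorem edgeExp_ins_update {u : Fin n → Bool} {i : Fin n} (h : u i = false) :
    edgeExp (ins k false (Function.update u i true)) k =
      (if k.succAbove i < k then 1 else 0) + edgeExp (ins k false u) k := by
  rw [edgeExp_ins_same, edgeExp_ins_same, ← Finset.add_sum_erase _ _ (Finset.mem_univ i),
    ← Finset.add_sum_erase (Finset.univ : Finset (Fin n)) (fun j =>
      if k.succAbove j < k ∧ u j = true then 1 else 0) (Finset.mem_univ i)]
  simp only [Function.update_self, and_true, h, Bool.false_eq_true, and_false, if_false, zero_add]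
  congr 1
  refine Finset.sum_congr rfl fun j hj => ?_
  rw [Function.update_of_ne (Finset.ne_of_mem_erase hj)]

/-- The two ways around a square of the cube have opposite signs. -/
theorem sign_anticomm {u : Fin n → Bool} {i : Fin n} (h : u i = false) :
    (-1 : ℤ) ^ edgeExp (ins k false u) k * (-1) ^ edgeExp (ins k true u) (k.succAbove i) =
      -((-1) ^ edgeExp u i * (-1) ^ edgeExp (ins k false (Function.update u i true)) k) := by
  rw [edgeExp_ins, edgeExp_ins_update k h, pow_add, pow_add]
  -- Of the crossings `k` and `i`, the earlier one contributes an extra `1` before the later one on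
  -- exactly one of the two routes.
  rcases lt_or_gt_of_ne (Fin.ne_succAbove k i) with hlt | hgt
  · rw [if_pos ⟨hlt, rfl⟩, if_neg hlt.not_gt]
    ring
  · rw [if_neg (fun h => hgt.not_gt h.1), if_pos hgt]
    ring

end

/-! ## Positive kinks -/

namespace Diagram

/-- Multiplication by `u₋` in the factor of the circle through `p`, in all resolutions. -/
def dotMap {n : ℕ} (D : Diagram n) (p : D.Pt) : D.CKh →ₗ[ℤ] D.CKh :=
  Finsupp.linearCombination ℤ fun s => D.block s.1 (dot (D.res s.1) p (Finsupp.single s.2 1))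

theorem dotMap_block {n : ℕ} (D : Diagram n) (p : D.Pt) (v : Fin n → Bool)
    (x : TensorPower (D.res v)) : D.dotMap p (D.block v x) = D.block v (dot (D.res v) p x) := by
  refine linearMap_ext_single (F := D.dotMap p ∘ₗ D.block v)
    (G := D.block v ∘ₗ dot (D.res v) p) (fun l => ?_) x
  rw [LinearMap.comp_apply, LinearMap.comp_apply, block_single, dotMap,
    Finsupp.linearCombination_single, one_smul]

/-- Every edge map is a surgery and hence equivariant, and the action does not move the vertex, so
no sign appears. -/
theorem dotMap_d {n : ℕ} (D : Diagram n) (p : D.Pt) (x : D.CKh) :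
    D.dotMap p (D.d x) = D.d (D.dotMap p x) := by
  suffices H : D.dotMap p ∘ₗ D.d = D.d ∘ₗ D.dotMap p from LinearMap.congr_fun H x
  refine linearMap_ext_block fun v x => ?_
  rw [LinearMap.comp_apply, LinearMap.comp_apply, d_block, dotMap_block, d_block, map_sum]
  refine Finset.sum_congr rfl fun c _ => ?_
  split_ifs with hc
  · rw [map_smul, dotMap_block, edge, surgery_dot (D.isSurgery_cross hc)]
  · rw [map_zero]

theorem dotMap_single_apply {n : ℕ} (D : Diagram n) (p : D.Pt) (s t : D.State) :
    D.dotMap p (Finsupp.single s 1) t =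
      if t.1 = s.1 ∧ s.label p = .plus ∧ t.label p = .minus ∧
        ∀ p', ¬ D.res s.1 p' p → t.label p' = s.label p' then 1 else 0 := by
  obtain ⟨v, l⟩ := s
  obtain ⟨v', l'⟩ := t
  rw [← block_single, dotMap_block]
  by_cases hv : v' = v
  · subst hv
    have key : Function.update l (Quotient.mk _ p) .minus = l' ↔
        l' (Quotient.mk _ p) = .minus ∧
          ∀ p', ¬ D.res v' p' p → l' (Quotient.mk _ p') = l (Quotient.mk _ p') := by
      constructor
      · rintro rfl
        refine ⟨Function.update_self _ _ _, fun p' hp' => ?_⟩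
        rw [update_mk, if_neg hp']
      · rintro ⟨h, h'⟩
        funext y
        obtain ⟨x, rfl⟩ := Quotient.exists_rep y
        rw [update_mk]
        split_ifs with hx
        · rw [mk_congr hx, h]
        · exact (h' x hx).symm
    rw [block_apply, dot_single]
    by_cases hl : l (Quotient.mk _ p) = .plus
    · rw [if_pos hl, Finsupp.single_apply, if_congr key rfl rfl]
      refine if_congr ?_ rfl rfl
      exact ⟨fun h => ⟨rfl, hl, h⟩, fun h => h.2.2⟩
    · rw [if_neg hl, if_neg (fun h => hl h.2.1)]
      rfl
  · rw [block_apply_ne _ _ hv, if_neg (fun h => hv h.1)]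

theorem State.ext_label {n : ℕ} {D : Diagram n} {s t : D.State} (h : s.1 = t.1)
    (h' : ∀ p, s.label p = t.label p) : s = t := by
  obtain ⟨v, l⟩ := s
  obtain ⟨v', l'⟩ := t
  obtain rfl : v = v' := h
  congr 1
  funext y
  obtain ⟨p, rfl⟩ := Quotient.exists_rep y
  exact h' p

theorem State.label_congr {n : ℕ} {D : Diagram n} (s : D.State) {p p' : D.Pt}
    (h : D.res s.1 p p') : s.label p = s.label p' :=
  congrArg s.2 (mk_congr h)

theorem block_surgery_congr {n : ℕ} (D : Diagram n) {v t t' : Fin n → Bool} (h : t = t')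
    (a b : D.Pt) (x : TensorPower (D.res v)) :
    D.block t (surgery (D.res v) (D.res t) a b x) =
      D.block t' (surgery (D.res v) (D.res t') a b x) := by
  subst h
  rfl

end Diagram

/-- The diagram `D'` is `D` with a positive kink, whose crossing is `k`.  Points of `D` are points
of `D'` by `φ`, the kink is added to the strand through `q`, and `c` lies on the loop. -/
structure IsKink {n : ℕ} (D : Diagram n) (D' : Diagram (n + 1)) (k : Fin (n + 1))
    (φ : D.Pt → D'.Pt) (q : D.Pt) (c : D'.Pt) : Prop where
  cross_eq : ∀ i a, D'.cross (k.succAbove i) a = φ (D.cross i a)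
  rel_iff : ∀ b u p p', D'.res (ins k b u) (φ p) (φ p') ↔ D.res u p p'
  not_rel_loop : ∀ u p, ¬ D'.res (ins k false u) (φ p) c
  loop_or : ∀ u x, D'.res (ins k false u) x c ∨ ∃ p, D'.res (ins k false u) (φ p) x
  exists_rel : ∀ u x, ∃ p, D'.res (ins k true u) (φ p) x
  loop_rel : ∀ u, D'.res (ins k true u) c (φ q)
  kink_merge : ∀ u, D'.res (ins k true u) (D'.cross k 0) (D'.cross k 2)
  kink : ∀ u, (D'.res (ins k false u) (D'.cross k 0) c ∧
      D'.res (ins k false u) (D'.cross k 2) (φ q)) ∨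
    (D'.res (ins k false u) (D'.cross k 0) (φ q) ∧ D'.res (ins k false u) (D'.cross k 2) c)

namespace IsKink

variable {n : ℕ} {D : Diagram n} {D' : Diagram (n + 1)} {k : Fin (n + 1)}
  {φ : D.Pt → D'.Pt} {q : D.Pt} {c : D'.Pt}

theorem isSurgery_cross (h : IsKink D D' k φ q c) (b : Bool) {u : Fin n → Bool} {i : Fin n}
    (hi : u i = false) : IsSurgery (D'.res (ins k b u)) (D'.res (ins k b (Function.update u i true)))
      (φ (D.cross i 0)) (φ (D.cross i 2)) := by
  rw [← h.cross_eq, ← h.cross_eq, ← update_ins]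
  exact D'.isSurgery_cross (by rw [ins_succAbove, hi])

theorem isSurgery_kink (D' : Diagram (n + 1)) (k : Fin (n + 1)) (u : Fin n → Bool) :
    IsSurgery (D'.res (ins k false u)) (D'.res (ins k true u)) (D'.cross k 0) (D'.cross k 2) := by
  rw [← update_ins_same]
  exact D'.isSurgery_cross (ins_same k false u)

/-- The kink crossing contributes an edge only when it is `0`-resolved; the other edges are those of
the cube of `D`, seen through `φ`. -/
theorem d_block (h : IsKink D D' k φ q c) (b : Bool) (u : Fin n → Bool)
    (x : TensorPower (D'.res (ins k b u))) :
    D'.d (D'.block (ins k b u) x) =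
      (if b = false then ((-1 : ℤ) ^ edgeExp (ins k b u) k) • D'.block (ins k true u)
        (surgery _ _ (D'.cross k 0) (D'.cross k 2) x) else 0) +
      ∑ i : Fin n, if u i = false then ((-1 : ℤ) ^ edgeExp (ins k b u) (k.succAbove i)) •
        D'.block (ins k b (Function.update u i true))
          (surgery _ _ (φ (D.cross i 0)) (φ (D.cross i 2)) x) else 0 := by
  rw [D'.d_block, Fin.sum_univ_succAbove _ k, ins_same]
  congr 1
  · split_ifs with hb
    · subst hb
      rw [Diagram.edge, D'.block_surgery_congr (update_ins_same k u)]
    · rfl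
  · refine Finset.sum_congr rfl fun i _ => ?_
    rw [ins_succAbove, Diagram.edge, D'.block_surgery_congr (update_ins k b u i), h.cross_eq,
      h.cross_eq]

variable (D D' k φ c)

/-- The labelled resolutions of `D'` with a loop labelled by `g`. -/
def loopState (g : Gen) (s : D.State) : D'.State :=
  ⟨ins k false s.1, Function.update (extendLabel φ (D.res s.1) (D'.res (ins k false s.1)) s.2)
    (Quotient.mk _ c) g⟩

/-- The labelled resolutions of `D'` without a loop. -/
def crossState (s : D.State) : D'.State :=
  ⟨ins k true s.1, extendLabel φ (D.res s.1) (D'.res (ins k true s.1)) s.2⟩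

/-- The inclusion of `CKh(D)` onto the summand with a loop labelled by `g`. -/
def loopMap (g : Gen) : D.CKh →ₗ[ℤ] D'.CKh := Finsupp.lmapDomain ℤ ℤ (loopState D D' k φ c g)

/-- The inclusion of `CKh(D)` onto the summand without a loop. -/
def crossMap : D.CKh →ₗ[ℤ] D'.CKh := Finsupp.lmapDomain ℤ ℤ (crossState D D' k φ)

/-- The sign of the edges of the cube that change the crossing `k`. -/
def signMap (D : Diagram n) (k : Fin (n + 1)) : D.CKh →ₗ[ℤ] D.CKh :=
  Finsupp.linearCombination ℤ fun s =>
    (-1 : ℤ) ^ edgeExp (ins k false s.1) k • Finsupp.single s 1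

theorem signMap_block (u : Fin n → Bool) (x : TensorPower (D.res u)) :
    signMap D k (D.block u x) = (-1 : ℤ) ^ edgeExp (ins k false u) k • D.block u x := by
  refine Diagram.linearMap_ext_single (F := signMap D k ∘ₗ D.block u)
    (G := (-1 : ℤ) ^ edgeExp (ins k false u) k • D.block u) (fun l => ?_) x
  rw [LinearMap.comp_apply, LinearMap.smul_apply, Diagram.block_single, signMap,
    Finsupp.linearCombination_single, one_smul]

theorem signMap_signMap (x : D.CKh) : signMap D k (signMap D k x) = x := by
  suffices H : signMap D k ∘ₗ signMap D k = LinearMap.id from LinearMap.congr_fun H x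
  refine Diagram.linearMap_ext_block fun v x => ?_
  rw [LinearMap.comp_apply, signMap_block, map_smul, signMap_block, smul_smul, ← mul_pow]
  simp

theorem crossMap_block (u : Fin n → Bool) (x : TensorPower (D.res u)) :
    crossMap D D' k φ (D.block u x) =
      D'.block (ins k true u) (incl φ (D.res u) (D'.res (ins k true u)) x) := by
  refine Diagram.linearMap_ext_single (F := crossMap D D' k φ ∘ₗ D.block u)
    (G := D'.block (ins k true u) ∘ₗ incl φ (D.res u) (D'.res (ins k true u))) (fun l => ?_) x
  rw [LinearMap.comp_apply, LinearMap.comp_apply, Diagram.block_single, incl_single,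
    Diagram.block_single, crossMap, Finsupp.lmapDomain_apply, Finsupp.mapDomain_single]
  rfl

variable {D D' k φ c}

theorem extendLabel_loop (h : IsKink D D' k φ q c) (u : Fin n → Bool)
    (l : D.Circle u → Gen) : extendLabel φ (D.res u) (D'.res (ins k false u)) l
      (Quotient.mk _ c) = .plus :=
  extendLabel_of_not (h.not_rel_loop u)

theorem loopMap_plus_block (h : IsKink D D' k φ q c) (u : Fin n → Bool)
    (x : TensorPower (D.res u)) : loopMap D D' k φ c .plus (D.block u x) =
      D'.block (ins k false u) (incl φ (D.res u) (D'.res (ins k false u)) x) := by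
  refine Diagram.linearMap_ext_single (F := loopMap D D' k φ c .plus ∘ₗ D.block u)
    (G := D'.block (ins k false u) ∘ₗ incl φ (D.res u) (D'.res (ins k false u))) (fun l => ?_) x
  rw [LinearMap.comp_apply, LinearMap.comp_apply, Diagram.block_single, incl_single,
    Diagram.block_single, loopMap, Finsupp.lmapDomain_apply, Finsupp.mapDomain_single, loopState]
  rw [← extendLabel_loop h u l, Function.update_eq_self]

theorem loopMap_minus_block (h : IsKink D D' k φ q c) (u : Fin n → Bool)
    (x : TensorPower (D.res u)) : loopMap D D' k φ c .minus (D.block u x) =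
      D'.block (ins k false u)
        (dot (D'.res (ins k false u)) c (incl φ (D.res u) (D'.res (ins k false u)) x)) := by
  refine Diagram.linearMap_ext_single (F := loopMap D D' k φ c .minus ∘ₗ D.block u)
    (G := D'.block (ins k false u) ∘ₗ dot (D'.res (ins k false u)) c ∘ₗ
      incl φ (D.res u) (D'.res (ins k false u))) (fun l => ?_) x
  rw [LinearMap.comp_apply, LinearMap.comp_apply, LinearMap.comp_apply, Diagram.block_single,
    incl_single, dot_single, if_pos (extendLabel_loop h u l), Diagram.block_single, loopMap,
    Finsupp.lmapDomain_apply, Finsupp.mapDomain_single]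
  rfl

/-- The opposite ends of the kink crossing lie one on the loop and one on the strand, so the surgery
is a merge; the loop carries `u₊`, the unit of `m`. -/
theorem surgery_kink (h : IsKink D D' k φ q c) (u : Fin n → Bool) (x : TensorPower (D.res u)) :
    surgery (D'.res (ins k false u)) (D'.res (ins k true u)) (D'.cross k 0) (D'.cross k 2)
      (incl φ (D.res u) (D'.res (ins k false u)) x) =
        incl φ (D.res u) (D'.res (ins k true u)) x := by
  have hs := isSurgery_kink D' k u
  set r := D'.res (ins k false u)
  set r' := D'.res (ins k true u)
  have hr : ∀ p, ¬ r (φ p) c := h.not_rel_loop u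
  have hnot : ¬ r (D'.cross k 0) (D'.cross k 2) := by
    intro e
    rcases h.kink u with ⟨h1, h2⟩ | ⟨h1, h2⟩
    · exact hr q (r.trans (r.symm h2) (r.trans (r.symm e) h1))
    · exact hr q (r.trans (r.symm h1) (r.trans e h2))
  have hrel : r' (D'.cross k 0) (D'.cross k 2) := h.kink_merge u
  suffices H : surgery r r' (D'.cross k 0) (D'.cross k 2) ∘ₗ incl φ (D.res u) r =
      incl φ (D.res u) r' from LinearMap.congr_fun H x
  refine linearMap_ext_unit (fun p => dot r' (φ p)) (fun p x => ?_) (fun p x => ?_) ?_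
  · rw [LinearMap.comp_apply, LinearMap.comp_apply, incl_dot (h.rel_iff false u), surgery_dot hs]
  · rw [incl_dot (h.rel_iff true u)]
  · rw [LinearMap.comp_apply, incl_unit, incl_unit, surgery_unit_of_merge hs hnot hrel]

/-- By `m (x ⊗ u₊) = x`, the component into the `1`-resolved summand is the identity up to the sign
recorded by `signMap`. This is the isomorphism that gets cancelled. -/
theorem d_loopMap_plus (h : IsKink D D' k φ q c) (z : D.CKh) :
    D'.d (loopMap D D' k φ c .plus z) =
      loopMap D D' k φ c .plus (D.d z) + crossMap D D' k φ (signMap D k z) := by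
  suffices H : D'.d ∘ₗ loopMap D D' k φ c .plus = loopMap D D' k φ c .plus ∘ₗ D.d +
      crossMap D D' k φ ∘ₗ signMap D k from LinearMap.congr_fun H z
  refine Diagram.linearMap_ext_block fun u x => ?_
  rw [LinearMap.comp_apply, LinearMap.add_apply, LinearMap.comp_apply, LinearMap.comp_apply,
    loopMap_plus_block h, h.d_block, D.d_block, signMap_block, map_smul, crossMap_block, if_pos rfl,
    surgery_kink h, map_sum]
  refine (add_comm _ _).trans (congrArg (· + _) ?_)
  refine Finset.sum_congr rfl fun i _ => ?_
  split_ifs with hi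
  · rw [map_smul, loopMap_plus_block h, edgeExp_ins, if_neg (by simp), zero_add, Diagram.edge,
      incl_surgery (h.rel_iff _ _) (h.rel_iff _ _) (D.isSurgery_cross hi)
        (h.isSurgery_cross false hi)]
  · rw [map_zero]

/-- Merging a loop labelled `u₋` multiplies the strand through `q` by `u₋`. -/
theorem d_loopMap_minus (h : IsKink D D' k φ q c) (z : D.CKh) :
    D'.d (loopMap D D' k φ c .minus z) =
      loopMap D D' k φ c .minus (D.d z) +
        crossMap D D' k φ (signMap D k (D.dotMap q z)) := by
  suffices H : D'.d ∘ₗ loopMap D D' k φ c .minus = loopMap D D' k φ c .minus ∘ₗ D.d +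
      crossMap D D' k φ ∘ₗ signMap D k ∘ₗ D.dotMap q from LinearMap.congr_fun H z
  refine Diagram.linearMap_ext_block fun u x => ?_
  rw [LinearMap.comp_apply, LinearMap.add_apply, LinearMap.comp_apply, LinearMap.comp_apply,
    LinearMap.comp_apply, loopMap_minus_block h, h.d_block, D.d_block, D.dotMap_block,
    signMap_block, map_smul, crossMap_block, if_pos rfl, surgery_dot (isSurgery_kink D' k u),
    surgery_kink h, dot_congr (h.loop_rel u), incl_dot (h.rel_iff true u), map_sum]
  refine (add_comm _ _).trans (congrArg (· + _) ?_)
  refine Finset.sum_congr rfl fun i _ => ?_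
  split_ifs with hi
  · rw [map_smul, loopMap_minus_block h, edgeExp_ins, if_neg (by simp), zero_add, Diagram.edge,
      surgery_dot (h.isSurgery_cross false hi),
      incl_surgery (h.rel_iff _ _) (h.rel_iff _ _) (D.isSurgery_cross hi)
        (h.isSurgery_cross false hi)]
  · rw [map_zero]

/-- With the identification twisted by `signMap`, anticommutativity of the signs around a square
makes this summand a copy of `CKh(D)` with differential `-d`. -/
theorem d_crossMap (h : IsKink D D' k φ q c) (z : D.CKh) :
    D'.d (crossMap D D' k φ (signMap D k z)) = -crossMap D D' k φ (signMap D k (D.d z)) := by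
  suffices H : D'.d ∘ₗ crossMap D D' k φ ∘ₗ signMap D k =
      -(crossMap D D' k φ ∘ₗ signMap D k ∘ₗ D.d) from LinearMap.congr_fun H z
  refine Diagram.linearMap_ext_block fun u x => ?_
  rw [LinearMap.neg_apply, LinearMap.comp_apply, LinearMap.comp_apply, LinearMap.comp_apply,
    LinearMap.comp_apply, signMap_block, map_smul, map_smul, crossMap_block, h.d_block,
    if_neg (by simp), zero_add, D.d_block, map_sum, map_sum, Finset.smul_sum,
    ← Finset.sum_neg_distrib]
  refine Finset.sum_congr rfl fun i _ => ?_
  split_ifs with hi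
  · rw [map_smul, signMap_block, map_smul, map_smul, crossMap_block, smul_smul, smul_smul,
      sign_anticomm k hi, neg_smul, Diagram.edge,
      incl_surgery (h.rel_iff _ _) (h.rel_iff _ _) (D.isSurgery_cross hi)
        (h.isSurgery_cross true hi)]
  · simp

/-! ### The summands of the complex of a kinked diagram -/

theorem label_loopState (h : IsKink D D' k φ q c) (g : Gen) (s : D.State) (p : D.Pt) :
    (loopState D D' k φ c g s).label (φ p) = s.label p := by
  have := update_mk (D'.res (ins k false s.1))
    (extendLabel φ (D.res s.1) (D'.res (ins k false s.1)) s.2) c (φ p) g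
  rw [if_neg (h.not_rel_loop s.1 p)] at this
  refine this.trans ?_
  exact extendLabel_mk (h.rel_iff false s.1) s.2 p

theorem label_loopState_loop (g : Gen) (s : D.State) :
    (loopState D D' k φ c g s).label c = g :=
  Function.update_self _ _ _

theorem label_crossState (h : IsKink D D' k φ q c) (s : D.State) (p : D.Pt) :
    (crossState D D' k φ s).label (φ p) = s.label p :=
  extendLabel_mk (h.rel_iff true s.1) s.2 p

theorem fst_injective {b : Bool} {s s' : D.State} (h : ins k b s.1 = ins k b s'.1) :
    s.1 = s'.1 := by
  funext i
  rw [← ins_succAbove k b s.1, h, ins_succAbove]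

theorem loopState_injective (h : IsKink D D' k φ q c) (g : Gen) :
    Function.Injective (loopState D D' k φ c g) := by
  intro s s' e
  refine Diagram.State.ext_label (fst_injective (congrArg Sigma.fst e)) fun p => ?_
  rw [← label_loopState h g s, e, label_loopState h]

theorem crossState_injective (h : IsKink D D' k φ q c) :
    Function.Injective (crossState D D' k φ) := by
  intro s s' e
  refine Diagram.State.ext_label (fst_injective (congrArg Sigma.fst e)) fun p => ?_
  rw [← label_crossState h s, e, label_crossState h]

theorem loopState_ne {s s' : D.State} :
    loopState D D' k φ c .plus s ≠ loopState D D' k φ c .minus s' := by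
  intro e
  have := label_loopState_loop (D' := D') (k := k) (φ := φ) (c := c) .plus s
  rw [e, label_loopState_loop] at this
  exact Gen.noConfusion this

theorem loopState_ne_crossState {g : Gen} {s s' : D.State} :
    loopState D D' k φ c g s ≠ crossState D D' k φ s' := by
  intro e
  have := congrFun (congrArg Sigma.fst e) k
  simp [loopState, crossState, ins_same] at this

/-- Every circle of `D'` other than the loop meets the image of `φ`, so a labelling is determined by
its pullback to `D` and, in the `0`-resolution of `k`, the label of the loop. -/
theorem exists_state (h : IsKink D D' k φ q c) (t : D'.State) :
    (∃ g s, t = loopState D D' k φ c g s) ∨ ∃ s, t = crossState D D' k φ s := by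
  obtain ⟨v, l⟩ := t
  obtain ⟨b, u, rfl⟩ : ∃ b u, v = ins k b u :=
    ⟨v k, fun i => v (k.succAbove i), (eq_ins_iff k).2 ⟨rfl, fun _ => rfl⟩⟩
  have hl : ∀ p p', D.res u p p' → l (Quotient.mk _ (φ p)) = l (Quotient.mk _ (φ p')) :=
    fun p p' hp => congrArg l (mk_congr ((h.rel_iff b u p p').2 hp))
  let l₀ : D.Circle u → Gen := Quotient.lift (fun p => l (Quotient.mk _ (φ p))) hl
  cases b
  · refine Or.inl ⟨l (Quotient.mk _ c), ⟨u, l₀⟩, Diagram.State.ext_label rfl fun x => ?_⟩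
    rcases h.loop_or u x with hx | ⟨p, hp⟩
    · rw [Diagram.State.label_congr ⟨ins k false u, l⟩ hx,
        Diagram.State.label_congr (loopState D D' k φ c _ ⟨u, l₀⟩) hx, label_loopState_loop]
      rfl
    · rw [← Diagram.State.label_congr ⟨ins k false u, l⟩ hp,
        ← Diagram.State.label_congr (loopState D D' k φ c _ ⟨u, l₀⟩) hp, label_loopState h]
      rfl
  · refine Or.inr ⟨⟨u, l₀⟩, Diagram.State.ext_label rfl fun x => ?_⟩
    obtain ⟨p, hp⟩ := h.exists_rel u x
    rw [← Diagram.State.label_congr ⟨ins k true u, l⟩ hp,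
      ← Diagram.State.label_congr (crossState D D' k φ ⟨u, l₀⟩) hp, label_crossState h]
    rfl

theorem exists_decomposition (h : IsKink D D' k φ q c) (y : D'.CKh) :
    ∃ z z' z'', y = loopMap D D' k φ c .minus z + loopMap D D' k φ c .plus z' +
      crossMap D D' k φ z'' := by
  induction y using Finsupp.induction_linear with
  | zero => exact ⟨0, 0, 0, by simp⟩
  | add y₁ y₂ h₁ h₂ =>
    obtain ⟨z₁, z₁', z₁'', rfl⟩ := h₁
    obtain ⟨z₂, z₂', z₂'', rfl⟩ := h₂
    refine ⟨z₁ + z₂, z₁' + z₂', z₁'' + z₂'', ?_⟩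
    simp only [map_add]
    abel
  | single t a =>
    rcases exists_state h t with ⟨g, s, rfl⟩ | ⟨s, rfl⟩
    · cases g
      · exact ⟨0, Finsupp.single s a, 0, by simp [loopMap]⟩
      · exact ⟨Finsupp.single s a, 0, 0, by simp [loopMap]⟩
    · exact ⟨0, 0, Finsupp.single s a, by simp [crossMap]⟩

theorem loopMap_single (g : Gen) (s : D.State) :
    loopMap D D' k φ c g (Finsupp.single s 1) =
      Finsupp.single (loopState D D' k φ c g s) 1 := by
  simp [loopMap]

theorem loopMap_apply_self (h : IsKink D D' k φ q c) (g : Gen) (z : D.CKh) (s : D.State) :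
    loopMap D D' k φ c g z (loopState D D' k φ c g s) = z s :=
  Finsupp.mapDomain_apply (loopState_injective h g) _ _

theorem loopMap_apply_of_forall {g : Gen} {t : D'.State}
    (h : ∀ s, loopState D D' k φ c g s ≠ t) (z : D.CKh) : loopMap D D' k φ c g z t = 0 :=
  Finsupp.mapDomain_of_notMem_range _ _ fun ⟨s, hs⟩ => h s hs

theorem crossMap_apply_self (h : IsKink D D' k φ q c) (z : D.CKh) (s : D.State) :
    crossMap D D' k φ z (crossState D D' k φ s) = z s :=
  Finsupp.mapDomain_apply (crossState_injective h) _ _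

theorem crossMap_apply_of_forall {t : D'.State}
    (h : ∀ s, crossState D D' k φ s ≠ t) (z : D.CKh) : crossMap D D' k φ z t = 0 :=
  Finsupp.mapDomain_of_notMem_range _ _ fun ⟨s, hs⟩ => h s hs

theorem decomposition_unique (h : IsKink D D' k φ q c) {z z' z'' : D.CKh}
    (e : loopMap D D' k φ c .minus z + loopMap D D' k φ c .plus z' + crossMap D D' k φ z'' = 0) :
    z = 0 ∧ z' = 0 ∧ z'' = 0 := by
  refine ⟨?_, ?_, ?_⟩ <;> ext s
  · have := DFunLike.congr_fun e (loopState D D' k φ c .minus s)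
    rwa [Finsupp.add_apply, Finsupp.add_apply, loopMap_apply_self h,
      loopMap_apply_of_forall (fun _ => loopState_ne),
      crossMap_apply_of_forall (fun _ => loopState_ne_crossState.symm), add_zero,
      add_zero] at this
  · have := DFunLike.congr_fun e (loopState D D' k φ c .plus s)
    rwa [Finsupp.add_apply, Finsupp.add_apply, loopMap_apply_self h,
      loopMap_apply_of_forall (fun _ => loopState_ne.symm),
      crossMap_apply_of_forall (fun _ => loopState_ne_crossState.symm), zero_add,
      add_zero] at this
  · have := DFunLike.congr_fun e (crossState D D' k φ s)
    rwa [Finsupp.add_apply, Finsupp.add_apply, crossMap_apply_self h,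
      loopMap_apply_of_forall (fun _ => loopState_ne_crossState),
      loopMap_apply_of_forall (fun _ => loopState_ne_crossState), zero_add, zero_add] at this

/-- The correction term of `ρ₁ u₊` lowers the strand to `u₋` and labels the loop `u₊`. It vanishes
on `u₋`, as `dot` does. -/
theorem rho₁_eq (h : IsKink D D' k φ q c) (z : D.CKh) : rho₁ D D' k φ q c z =
    loopMap D D' k φ c .minus z - loopMap D D' k φ c .plus (D.dotMap q z) := by
  suffices H : rho₁ D D' k φ q c = loopMap D D' k φ c .minus -
      loopMap D D' k φ c .plus ∘ₗ D.dotMap q from LinearMap.congr_fun H z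
  refine Finsupp.lhom_ext' fun s => LinearMap.ext_ring ?_
  ext t
  rw [LinearMap.comp_apply, LinearMap.comp_apply, LinearMap.sub_apply, LinearMap.comp_apply,
    Finsupp.lsingle_apply, rho₁, ofCoeff_single, Finsupp.sub_apply]
  rcases exists_state h t with ⟨g, s', rfl⟩ | ⟨s', rfl⟩
  · have h1 : (loopState D D' k φ c g s').1 k = false := ins_same k false s'.1
    have h2 : (∀ j, (loopState D D' k φ c g s').1 (k.succAbove j) = s.1 j) ↔ s'.1 = s.1 := by
      rw [funext_iff]
      exact forall_congr' fun j => Eq.congr_left (ins_succAbove k false s'.1 j)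
    have h3 : (∀ p, s'.label p = s.label p) ∧ s'.1 = s.1 ↔ s = s' :=
      ⟨fun hs => (Diagram.State.ext_label hs.2 hs.1).symm, by rintro rfl; simp⟩
    simp only [h1, h2, true_and, label_loopState h, label_loopState_loop]
    cases g
    · rw [loopMap_apply_of_forall (fun _ => loopState_ne.symm), loopMap_apply_self h, Diagram.dotMap_single_apply, zero_sub]
      simp only [true_and, reduceCtorEq, false_and, if_false]
      split_ifs <;> first | rfl | (exfalso; tauto)
    · rw [loopMap_apply_of_forall (fun _ => loopState_ne), loopMap_apply_self h, sub_zero,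
        Finsupp.single_apply, ← if_congr h3 rfl rfl]
      simp only [true_and, reduceCtorEq, false_and, and_false, if_false]
      rw [← ite_and, if_congr and_comm rfl rfl]
  · rw [if_neg, loopMap_apply_of_forall (fun _ => loopState_ne_crossState),
      loopMap_apply_of_forall (fun _ => loopState_ne_crossState), sub_zero]
    rintro ⟨h1, -⟩
    simp [crossState, ins_same] at h1

theorem rho₁_minus (h : IsKink D D' k φ q c) (u : Fin n → Bool) :
    rho₁ D D' k φ q c (Finsupp.single ⟨u, fun _ => .minus⟩ 1) =
      Finsupp.single ⟨ins k false u, fun _ => .minus⟩ 1 := by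
  have h0 : D.dotMap q (Finsupp.single ⟨u, fun _ => .minus⟩ 1) = 0 := by
    rw [← Diagram.block_single, Diagram.dotMap_block, dot_single, if_neg (by simp), map_zero]
  rw [rho₁_eq h, h0, map_zero, sub_zero, loopMap_single]
  congr 1
  refine Diagram.State.ext_label rfl fun x => ?_
  rcases h.loop_or u x with hx | ⟨p, hx⟩
  · rw [Diagram.State.label_congr (loopState D D' k φ c _ _) hx, label_loopState_loop]
    rfl
  · rw [← Diagram.State.label_congr (loopState D D' k φ c _ _) hx, label_loopState h]
    rfl

/-- The two contributions to the `1`-resolved summand are the same element, `u₋` times `z` at the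
strand, and cancel. -/
theorem isChainMap_rho₁ (h : IsKink D D' k φ q c) : IsChainMap (rho₁ D D' k φ q c) := by
  intro z
  rw [rho₁_eq h, rho₁_eq h, map_sub, d_loopMap_minus h, d_loopMap_plus h, Diagram.dotMap_d]
  abel

/-- The map of the Reidemeister move that adds a positive kink is a quasi-isomorphism. -/
theorem isQuasiIso_rho₁ (h : IsKink D D' k φ q c) : IsQuasiIso (rho₁ D D' k φ q c) := by
  refine ⟨isChainMap_rho₁ h, ?_, ?_⟩
  · rw [injective_iff_map_eq_zero]
    intro x hx
    obtain ⟨⟨z, hz⟩, rfl⟩ := Submodule.Quotient.mk_surjective _ x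
    rw [IsChainMap.homMap, Submodule.mapQ_apply, Submodule.Quotient.mk_eq_zero] at hx
    obtain ⟨y, hy⟩ := hx
    change D'.d y = rho₁ D D' k φ q c z at hy
    rw [Submodule.Quotient.mk_eq_zero]
    obtain ⟨z₁, z₂, z₃, rfl⟩ := exists_decomposition h y
    obtain ⟨z₃, rfl⟩ : ∃ x, z₃ = signMap D k x := ⟨_, (signMap_signMap D k z₃).symm⟩
    rw [rho₁_eq h, map_add, map_add, d_loopMap_minus h, d_loopMap_plus h, d_crossMap h] at hy
    -- Only the `u₋`-loop component of `d y = ρ₁ z` is used: it reads `d z₁ = z`, so `z` is a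
    -- boundary.
    have := decomposition_unique h (z := D.d z₁ - z) (z' := D.d z₂ + D.dotMap q z)
      (z'' := signMap D k (D.dotMap q z₁) + signMap D k z₂ - signMap D k (D.d z₃)) (by
        rw [← sub_eq_zero] at hy
        rw [← hy]
        simp only [map_sub, map_add]
        abel)
    exact ⟨z₁, sub_eq_zero.1 this.1⟩
  · intro x
    obtain ⟨⟨y, hy⟩, rfl⟩ := Submodule.Quotient.mk_surjective _ x
    rw [LinearMap.mem_ker] at hy
    obtain ⟨z₁, z₂, z₃, rfl⟩ := exists_decomposition h y
    obtain ⟨z₃, rfl⟩ : ∃ x, z₃ = signMap D k x := ⟨_, (signMap_signMap D k z₃).symm⟩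
    have hy' := hy
    rw [map_add, map_add, d_loopMap_minus h, d_loopMap_plus h, d_crossMap h] at hy'
    obtain ⟨h1, -, h3⟩ := decomposition_unique h (z := D.d z₁) (z' := D.d z₂)
      (z'' := signMap D k (D.dotMap q z₁) + signMap D k z₂ - signMap D k (D.d z₃)) (by
        rw [← hy']
        simp only [map_sub, map_add]
        abel)
    -- This is the component of `d y = 0` in the `1`-resolved summand.
    have h4 : D.d z₃ = D.dotMap q z₁ + z₂ := by
      have := congrArg (signMap D k) h3
      rw [map_sub, map_add, signMap_signMap, signMap_signMap, signMap_signMap, map_zero] at this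
      exact (sub_eq_zero.1 this).symm
    refine ⟨Submodule.Quotient.mk ⟨z₁, LinearMap.mem_ker.2 h1⟩, ?_⟩
    rw [IsChainMap.homMap, Submodule.mapQ_apply, Submodule.Quotient.eq]
    -- The kink edge maps the `u₊`-loop copy of `z₃` onto the `1`-resolved part of `y`, so `y - ρ₁
    -- z₁ = d (loopMap .plus z₃)`.
    refine ⟨-loopMap D D' k φ c .plus z₃, ?_⟩
    change D'.d _ = rho₁ D D' k φ q c z₁ - (loopMap D D' k φ c .minus z₁ +
      loopMap D D' k φ c .plus z₂ + crossMap D D' k φ (signMap D k z₃))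
    rw [map_neg, d_loopMap_plus h, h4, rho₁_eq h, map_add]
    abel

end IsKink

/-! ## The kink of the intermediate diagram -/

namespace BraidPt

variable {m n : ℕ} (k : Fin (n + 1))

theorem skip_injective : Function.Injective (skip (m := m) k) := by
  intro x y h
  cases x <;> cases y <;> simp_all [skip]

theorem skip_ne_lo (x : BraidPt m n) (i : Fin (m + 1)) : skip k x ≠ lo k i := by
  cases x <;> simp [skip, Fin.succAbove_ne]

theorem skip_ne_hi (x : BraidPt m n) (i : Fin (m + 1)) : skip k x ≠ hi k i := by
  cases x <;> simp [skip, Fin.succAbove_ne]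

theorem exists_skip_or (x : BraidPt m (n + 1)) :
    (∃ p, x = skip k p) ∨ ∃ i, x = lo k i ∨ x = hi k i := by
  cases x with
  | base j => exact Or.inl ⟨base j, rfl⟩
  | lo k' i =>
    by_cases h : k' = k
    · exact Or.inr ⟨i, Or.inl (by rw [h])⟩
    · obtain ⟨j, rfl⟩ := Fin.exists_succAbove_eq h
      exact Or.inl ⟨lo j i, rfl⟩
  | hi k' i =>
    by_cases h : k' = k
    · exact Or.inr ⟨i, Or.inr (by rw [h])⟩
    · obtain ⟨j, rfl⟩ := Fin.exists_succAbove_eq h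
      exact Or.inl ⟨hi j i, rfl⟩

/-- Deleting level `k` fuses the arcs `k.castSucc` and `k.succ` into arc `k`, which is the
reindexing `k.predAbove`. The excluded arc starts at the deleted point `hi k i`. -/
theorem skip_bottom {t : Fin (n + 2)} (ht : t ≠ k.succ) (i : Fin (m + 1)) :
    skip k (bottom (k.predAbove t) i) = bottom t i := by
  induction t using Fin.cases with
  | zero => simp [Fin.predAbove_right_zero, bottom_zero, skip]
  | succ s =>
    obtain ⟨s', rfl⟩ := Fin.exists_succAbove_eq (x := s) (y := k) (fun h => ht (by rw [h]))
    have : k.predAbove (k.succAbove s').succ = s'.succ := by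
      rcases lt_or_ge s'.castSucc k with h | h
      · rw [Fin.succAbove_of_castSucc_lt _ _ h, Fin.predAbove_of_le_castSucc]
        · rfl
        · exact Fin.castSucc_le_castSucc_iff.2 (Fin.castSucc_lt_iff_succ_le.1 h)
      · rw [Fin.succAbove_of_le_castSucc _ _ h, Fin.predAbove_succ_of_le]
        exact h.trans (Fin.castSucc_lt_succ).le
    rw [this, bottom_succ, bottom_succ]
    rfl

theorem skip_top {t : Fin (n + 2)} (ht : t ≠ k.castSucc) (i : Fin (m + 1)) :
    skip k (top (k.predAbove t) i) = top t i := by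
  induction t using Fin.lastCases with
  | last => simp [Fin.predAbove_right_last, top_last, skip]
  | cast s =>
    obtain ⟨s', rfl⟩ := Fin.exists_succAbove_eq (x := s) (y := k) (fun h => ht (by rw [h]))
    have : k.predAbove (k.succAbove s').castSucc = s'.castSucc := by
      rcases lt_or_ge s'.castSucc k with h | h
      · rw [Fin.succAbove_of_castSucc_lt _ _ h, Fin.predAbove_castSucc_of_le _ _ h.le]
      · rw [Fin.succAbove_of_le_castSucc _ _ h, Fin.predAbove_of_castSucc_lt]
        · rfl
        · exact Fin.castSucc_lt_castSucc_iff.2 (h.trans_lt Fin.castSucc_lt_succ)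
    rw [this, top_castSucc, top_castSucc]
    rfl

end BraidPt

section

variable {m n : ℕ} (w : BraidWord m (n + 1)) (k : Fin (n + 1))

theorem closure_cross_succAbove (i : Fin n) (a : Fin 4) :
    (closure w).cross (k.succAbove i) a =
      BraidPt.skip k ((closure (resolve w k)).cross i a) := by
  by_cases hp : (w (k.succAbove i)).positive = true
  · rw [closure_cross_of_pos w hp, closure_cross_of_pos (resolve w k) hp]
    fin_cases a <;> rfl
  · rw [Bool.not_eq_true] at hp
    rw [closure_cross_of_neg w hp, closure_cross_of_neg (resolve w k) hp]
    fin_cases a <;> rfl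

variable (left : Bool)

/-- The circles of the intermediate diagram. -/
def kinkedRes (v : Fin (n + 1) → Bool) : Setoid (BraidPt m (n + 1)) :=
  handleRes w k.castSucc k.succ (stringAt w k left) v

variable (v : Fin (n + 1) → Bool)

/-- After the exchange of targets, the arc leaving `hi k` upwards ends at `lo k` on the same string.
This closes the loop of the kink. -/
theorem kinkedRes_loop :
    kinkedRes w k left v (.hi k (stringAt w k left)) (.lo k (stringAt w k left)) := by
  have := handleRes_joint w k.castSucc k.succ (stringAt w k left) v
    (.between k.succ (stringAt w k left))
  rw [swap_between_right] at this
  have h : (closure w).tgt (.between k.castSucc (stringAt w k left)) =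
    .lo k (stringAt w k left) := BraidPt.top_castSucc _ _
  rwa [h] at this

theorem kinkedRes_skip : kinkedRes w k left v (BraidPt.bottom k.castSucc (stringAt w k left))
    (BraidPt.top k.succ (stringAt w k left)) := by
  have := handleRes_joint w k.castSucc k.succ (stringAt w k left) v
    (.between k.castSucc (stringAt w k left))
  rwa [swap_between_left] at this

theorem kinkedRes_between {t : Fin (n + 2)} {i : Fin (m + 1)}
    (h : (t ≠ k.castSucc ∧ t ≠ k.succ) ∨ i ≠ stringAt w k left) :
    kinkedRes w k left v (BraidPt.bottom t i) (BraidPt.top t i) := by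
  have := handleRes_joint w k.castSucc k.succ (stringAt w k left) v (.between t i)
  rwa [swap_between_between h] at this

theorem stringAt_turn (h : turn w v k (stringAt w k !left) ≠ stringAt w k !left) :
    turn w v k (stringAt w k !left) = stringAt w k left := by
  have hv : v k = (w k).positive := by
    by_contra hv
    exact h (by rw [turn_of_ne w hv]; rfl)
  rw [turn_of_eq w hv]
  cases left <;> simp [stringAt]

theorem stringAt_ne : stringAt w k (!left) ≠ stringAt w k left := by
  cases left <;> simp [stringAt, Fin.ext_iff]

theorem stringAt_cases {i : Fin (m + 1)} (h : i = (w k).gen.castSucc ∨ i = (w k).gen.succ) :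
    i = stringAt w k left ∨ i = stringAt w k !left := by
  cases left <;> simp [stringAt] <;> tauto

/-- The two points of a string at the level of the kink lie on the same circle. -/
theorem kinkedRes_level (i : Fin (m + 1)) : kinkedRes w k left v (.lo k i) (.hi k i) := by
  by_cases hi : i = stringAt w k left
  · subst hi
    exact (kinkedRes w k left v).symm (kinkedRes_loop w k left v)
  · by_cases ht : turn w v k i = i
    · exact handleRes_through w _ _ _ ht
    · have h := handleRes_turn w k.castSucc k.succ (stringAt w k left) ht
      have hi' : i = stringAt w k !left := by
        refine (stringAt_cases w k left ?_).resolve_left hi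
        by_contra hc
        exact ht (turn_of_not_mem w v (fun e => hc (Or.inl e)) (fun e => hc (Or.inr e)))
      subst hi'
      -- When the remaining string turns back, its two ends are joined by a path that goes around
      -- the loop.
      rw [stringAt_turn w k left v ht] at h
      exact (kinkedRes w k left v).trans h.1 ((kinkedRes w k left v).trans
        ((kinkedRes w k left v).symm (kinkedRes_loop w k left v))
        ((kinkedRes w k left v).symm h.2))

theorem kinkedRes_lo {i : Fin (m + 1)} (hi : i ≠ stringAt w k left) :
    kinkedRes w k left v (BraidPt.skip k (.bottom k i)) (.lo k i) := by
  have := kinkedRes_between w k left v (t := k.castSucc) (Or.inr hi)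
  rwa [BraidPt.top_castSucc, ← BraidPt.skip_bottom k (castSucc_ne_succ k),
    Fin.predAbove_castSucc_self] at this

/-- Only the fused arc `t = k` is new. On the detached string it is the arc made by the handle; on
any other string it is the lower arc, the passage through level `k`, and the upper arc. -/
theorem kinkedRes_bottom_top (t : Fin (n + 1)) (i : Fin (m + 1)) :
    kinkedRes w k left v (BraidPt.skip k (.bottom t i)) (BraidPt.skip k (.top t i)) := by
  by_cases ht : t = k
  · subst ht
    have h1 := BraidPt.skip_bottom t (castSucc_ne_succ t) i
    have h2 := BraidPt.skip_top t (castSucc_ne_succ t).symm i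
    rw [Fin.predAbove_castSucc_self] at h1
    rw [Fin.predAbove_succ_self] at h2
    rw [h1, h2]
    by_cases hi : i = stringAt w t left
    · subst hi
      exact kinkedRes_skip w t left v
    · have h3 := kinkedRes_between w t left v (t := t.castSucc) (Or.inr hi)
      have h4 := kinkedRes_between w t left v (t := t.succ) (Or.inr hi)
      rw [BraidPt.top_castSucc] at h3
      exact (kinkedRes w t left v).trans h3
        ((kinkedRes w t left v).trans (kinkedRes_level w t left v i) h4)
  · obtain ⟨s, hs, h1, h2⟩ : ∃ s, k.predAbove s = t ∧ s ≠ k.castSucc ∧ s ≠ k.succ := by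
      refine ⟨k.castSucc.succAbove t, ?_, Fin.succAbove_ne _ _, ?_⟩
      · rcases lt_or_gt_of_ne ht with h | h
        · rw [Fin.succAbove_of_castSucc_lt _ _ (Fin.castSucc_lt_castSucc_iff.2 h),
            Fin.predAbove_castSucc_of_le _ _ h.le]
        · rw [Fin.succAbove_of_le_castSucc _ _ (Fin.castSucc_le_castSucc_iff.2 h.le),
            Fin.predAbove_succ_of_le _ _ h.le]
      · rcases lt_or_gt_of_ne ht with h | h
        · rw [Fin.succAbove_of_castSucc_lt _ _ (Fin.castSucc_lt_castSucc_iff.2 h)]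
          exact ((Fin.castSucc_lt_castSucc_iff.2 h).trans Fin.castSucc_lt_succ).ne
        · rw [Fin.succAbove_of_le_castSucc _ _ (Fin.castSucc_le_castSucc_iff.2 h.le)]
          exact fun h' => ht (Fin.succ_injective _ h')
    rw [← hs, BraidPt.skip_bottom k h2, BraidPt.skip_top k h1]
    exact kinkedRes_between w k left v (Or.inl ⟨h1, h2⟩)

theorem kinkedRes_of_res {p p' : BraidPt m n}
    (h : (closure (resolve w k)).res (fun i => v (k.succAbove i)) p p') :
    kinkedRes w k left v (BraidPt.skip k p) (BraidPt.skip k p') := by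
  suffices H : (closure (resolve w k)).res (fun i => v (k.succAbove i)) ≤
      Setoid.comap (BraidPt.skip k) (kinkedRes w k left v) from H h
  have cross := handleRes_of_cross (w := w) (t₁ := k.castSucc) (t₂ := k.succ)
    (j := stringAt w k left) (v := v)
  refine Diagram.res_le fun x y hxy => ?_
  change kinkedRes w k left v (BraidPt.skip k x) (BraidPt.skip k y)
  cases hxy with
  | joint j =>
    cases j with
    | between t i => exact kinkedRes_bottom_top w k left v t i
    | through i j h₁ h₂ =>
      exact handleRes_through w _ _ _ (turn_of_not_mem w v (k := k.succAbove i) h₁ h₂)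
  | zero₁ i h =>
    have := ((cross (k.succAbove i)).1 h).1
    rw [closure_cross_succAbove, closure_cross_succAbove] at this
    exact this
  | zero₂ i h =>
    have := ((cross (k.succAbove i)).1 h).2
    rw [closure_cross_succAbove, closure_cross_succAbove] at this
    exact this
  | one₁ i h =>
    have := ((cross (k.succAbove i)).2 h).1
    rw [closure_cross_succAbove, closure_cross_succAbove] at this
    exact this
  | one₂ i h =>
    have := ((cross (k.succAbove i)).2 h).2
    rw [closure_cross_succAbove, closure_cross_succAbove] at this
    exact this

/-! ### Comparing the circles of the kinked diagram with those of the resolved braid -/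

/-- The circle of the resolved braid that contains a point of the intermediate diagram, if the
point does not lie on the loop of the kink. -/
def toResolved (x : BraidPt m (n + 1)) :
    Option ((closure (resolve w k)).Circle fun i => v (k.succAbove i)) :=
  if h : ∃ p, BraidPt.skip k p = x then some (Quotient.mk _ h.choose)
  else if x.string = stringAt w k left then
    if v k = true then some (Quotient.mk _ (.bottom k (stringAt w k !left))) else none
  else some (Quotient.mk _ (.bottom k x.string))

theorem toResolved_skip (p : BraidPt m n) :
    toResolved w k left v (BraidPt.skip k p) = some (Quotient.mk _ p) := by
  have h : ∃ p', BraidPt.skip k p' = BraidPt.skip k p := ⟨p, rfl⟩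
  rw [toResolved, dif_pos h]
  exact congrArg (fun p => some (Quotient.mk _ p)) (BraidPt.skip_injective k h.choose_spec)

theorem toResolved_hi (i : Fin (m + 1)) :
    toResolved w k left v (.hi k i) = toResolved w k left v (.lo k i) := by
  rw [toResolved, toResolved, dif_neg (fun ⟨p, hp⟩ => BraidPt.skip_ne_hi k p i hp),
    dif_neg (fun ⟨p, hp⟩ => BraidPt.skip_ne_lo k p i hp)]
  rfl

theorem toResolved_lo {i : Fin (m + 1)} (hi : i ≠ stringAt w k left) :
    toResolved w k left v (.lo k i) = some (Quotient.mk _ (.bottom k i)) := by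
  rw [toResolved, dif_neg (fun ⟨p, hp⟩ => BraidPt.skip_ne_lo k p i hp)]
  exact if_neg hi

theorem toResolved_loop : toResolved w k left v (.lo k (stringAt w k left)) =
    if v k = true then some (Quotient.mk _ (.bottom k (stringAt w k !left))) else none := by
  rw [toResolved, dif_neg (fun ⟨p, hp⟩ => BraidPt.skip_ne_lo k p _ hp)]
  exact if_pos rfl

theorem res_bottom_top {m n : ℕ} (w : BraidWord m n) (v : Fin n → Bool) (t : Fin (n + 1))
    (i : Fin (m + 1)) : (closure w).res v (.bottom t i) (.top t i) :=
  Diagram.res_of_arc (D := closure w) (.joint (D := closure w) (BraidJoint.between t i))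

theorem some_mk_eq {P : Type} {r : Setoid P} {p p' : P} (h : r p p') :
    some (Quotient.mk r p) = some (Quotient.mk r p') := congrArg some (mk_congr h)

theorem toResolved_between (t : Fin (n + 2)) {i : Fin (m + 1)}
    (h : (t ≠ k.castSucc ∧ t ≠ k.succ) ∨ i ≠ stringAt w k left) :
    toResolved w k left v (.bottom t i) = toResolved w k left v (.top t i) := by
  by_cases h1 : t = k.castSucc
  · subst h1
    have hi : i ≠ stringAt w k left := by tauto
    rw [BraidPt.top_castSucc, ← BraidPt.skip_bottom k (castSucc_ne_succ k), toResolved_skip,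
      toResolved_lo w k left v hi, Fin.predAbove_castSucc_self]
    rfl
  · by_cases h2 : t = k.succ
    · subst h2
      have hi : i ≠ stringAt w k left := by tauto
      rw [BraidPt.bottom_succ, ← BraidPt.skip_top k h1, toResolved_skip, toResolved_hi,
        toResolved_lo w k left v hi, Fin.predAbove_succ_self]
      exact some_mk_eq (res_bottom_top _ _ _ _)
    · rw [← BraidPt.skip_bottom k h2, ← BraidPt.skip_top k h1, toResolved_skip, toResolved_skip]
      exact some_mk_eq (res_bottom_top _ _ _ _)

theorem toResolved_joint (i : BraidJoint w) : toResolved w k left v ((closure w).src i) =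
    toResolved w k left v ((closure w).tgt
      (Equiv.swap (.between k.castSucc (stringAt w k left)) (.between k.succ (stringAt w k left))
        i)) := by
  cases i with
  | between t i =>
    by_cases h : (t ≠ k.castSucc ∧ t ≠ k.succ) ∨ i ≠ stringAt w k left
    · rw [swap_between_between h]
      exact toResolved_between w k left v t h
    · have hi : i = stringAt w k left := by tauto
      subst hi
      by_cases h1 : t = k.castSucc
      · subst h1
        rw [swap_between_left]
        change toResolved w k left v (.bottom k.castSucc (stringAt w k left)) =
          toResolved w k left v (.top k.succ (stringAt w k left))
        rw [← BraidPt.skip_bottom k (castSucc_ne_succ k),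
          ← BraidPt.skip_top k (castSucc_ne_succ k).symm, toResolved_skip, toResolved_skip,
          Fin.predAbove_castSucc_self, Fin.predAbove_succ_self]
        exact some_mk_eq (res_bottom_top _ _ _ _)
      · have h2 : t = k.succ := by tauto
        subst h2
        rw [swap_between_right]
        change toResolved w k left v (.bottom k.succ (stringAt w k left)) =
          toResolved w k left v (.top k.castSucc (stringAt w k left))
        rw [BraidPt.bottom_succ, BraidPt.top_castSucc, toResolved_hi]
  | through k' i h₁ h₂ =>
    rw [swap_between_through]
    change toResolved w k left v (.lo k' i) = toResolved w k left v (.hi k' i)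
    by_cases hk : k' = k
    · subst hk
      rw [toResolved_hi]
    · obtain ⟨k', rfl⟩ := Fin.exists_succAbove_eq hk
      have e1 := toResolved_skip w k left v (.lo k' i)
      have e2 := toResolved_skip w k left v (.hi k' i)
      refine e1.trans (Eq.trans ?_ e2.symm)
      exact some_mk_eq (Diagram.res_of_arc (D := closure (resolve w k))
        (.joint (D := closure (resolve w k)) (BraidJoint.through k' i h₁ h₂)))

theorem toResolved_turn (h : v k = true) :
    toResolved w k left v (.lo k (w k).gen.castSucc) =
      toResolved w k left v (.lo k (w k).gen.succ) := by
  have key : toResolved w k left v (.lo k (stringAt w k left)) =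
      toResolved w k left v (.lo k (stringAt w k !left)) := by
    rw [toResolved_loop, if_pos h, toResolved_lo w k left v (stringAt_ne w k left)]
  cases left
  · exact key.symm
  · exact key

/-- A function constant along arcs separates circles. Since it inverts `BraidPt.skip` on circles, no
two circles of the resolved braid become joined; and its value `none` detects that the loop is
separate in the `0`-resolution. -/
theorem toResolved_eq_of_kinkedRes (hpos : (w k).positive = true) {x y : BraidPt m (n + 1)} (h : kinkedRes w k left v x y) :
    toResolved w k left v x = toResolved w k left v y := by
  suffices H : kinkedRes w k left v ≤ Setoid.ker (toResolved w k left v) from H h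
  have cross : ∀ (i : Fin n) a b, (closure (resolve w k)).res (fun i => v (k.succAbove i))
      ((closure (resolve w k)).cross i a) ((closure (resolve w k)).cross i b) →
      toResolved w k left v ((closure w).cross (k.succAbove i) a) =
        toResolved w k left v ((closure w).cross (k.succAbove i) b) := by
    intro i a b hi
    rw [closure_cross_succAbove, closure_cross_succAbove]
    exact (toResolved_skip w k left v _).trans
      ((some_mk_eq hi).trans (toResolved_skip w k left v _).symm)
  have hc := closure_cross_of_pos w hpos
  have key : ∀ x y : (kinked w k left).Pt, (kinked w k left).Arc v x y →
      toResolved w k left v x = toResolved w k left v y := by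
    intro x y hxy
    cases hxy with
    | joint i => exact toResolved_joint w k left v i
    | zero₁ i hv =>
      change toResolved w k left v ((closure w).cross i 0) =
        toResolved w k left v ((closure w).cross i 1)
      by_cases hi : i = k
      · subst hi
        rw [hc]
        exact (toResolved_hi _ _ _ _ _).symm
      · obtain ⟨i, rfl⟩ := Fin.exists_succAbove_eq hi
        exact cross i _ _ (Diagram.res_of_arc (.zero₁ i hv))
    | zero₂ i hv =>
      change toResolved w k left v ((closure w).cross i 2) =
        toResolved w k left v ((closure w).cross i 3)
      by_cases hi : i = k
      · subst hi
        rw [hc]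
        exact toResolved_hi _ _ _ _ _
      · obtain ⟨i, rfl⟩ := Fin.exists_succAbove_eq hi
        exact cross i _ _ (Diagram.res_of_arc (.zero₂ i hv))
    | one₁ i hv =>
      change toResolved w k left v ((closure w).cross i 0) =
        toResolved w k left v ((closure w).cross i 3)
      by_cases hi : i = k
      · subst hi
        rw [hc]
        exact (toResolved_turn w i left v hv).symm
      · obtain ⟨i, rfl⟩ := Fin.exists_succAbove_eq hi
        exact cross i _ _ (Diagram.res_of_arc (.one₁ i hv))
    | one₂ i hv =>
      change toResolved w k left v ((closure w).cross i 1) =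
        toResolved w k left v ((closure w).cross i 2)
      by_cases hi : i = k
      · subst hi
        rw [hc]
        change toResolved w i left v (.hi i _) = toResolved w i left v (.hi i _)
        rw [toResolved_hi, toResolved_hi]
        exact (toResolved_turn w i left v hv).symm
      · obtain ⟨i, rfl⟩ := Fin.exists_succAbove_eq hi
        exact cross i _ _ (Diagram.res_of_arc (.one₂ i hv))
  exact Setoid.eqvGen_le key

theorem kinkedRes_skip_iff (hpos : (w k).positive = true) (b : Bool) (u : Fin n → Bool)
    (p p' : BraidPt m n) :
    kinkedRes w k left (ins k b u) (BraidPt.skip k p) (BraidPt.skip k p') ↔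
      (closure (resolve w k)).res u p p' := by
  have hu : (fun i => ins k b u (k.succAbove i)) = u := funext fun i => ins_succAbove k b u i
  constructor
  · intro h
    have := toResolved_eq_of_kinkedRes w k left _ hpos h
    rw [toResolved_skip, toResolved_skip] at this
    have := Quotient.exact (Option.some.inj this)
    rwa [← hu]
  · intro h
    refine kinkedRes_of_res w k left _ ?_
    rwa [hu]

theorem kinkedRes_turn (hpos : (w k).positive = true) (h : v k = true) :
    kinkedRes w k left v (.lo k (w k).gen.castSucc) (.lo k (w k).gen.succ) := by
  have := handleRes_turn w k.castSucc k.succ (stringAt w k left) (v := v) (k := k)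
    (i := (w k).gen.castSucc)
  rw [turn_of_eq w (h.trans hpos.symm), Equiv.swap_apply_left] at this
  exact (this (castSucc_ne_succ _).symm).1

theorem kinkedRes_string (hpos : (w k).positive = true) (h : v k = true) :
    kinkedRes w k left v (.lo k (stringAt w k left)) (.lo k (stringAt w k !left)) := by
  have := kinkedRes_turn w k left v hpos h
  cases left
  · exact (kinkedRes w k _ v).symm this
  · exact this

/-- The intermediate diagram is the resolved braid with a positive kink. -/
theorem isKink_kinked (hpos : (w k).positive = true) : IsKink (closure (resolve w k)) (kinked w k left) k (BraidPt.skip k)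
    (BraidPt.bottom k (stringAt w k !left)) (BraidPt.lo k (stringAt w k left)) := by
  have symm : ∀ {v : Fin (n + 1) → Bool} {x y : BraidPt m (n + 1)},
      kinkedRes w k left v x y → kinkedRes w k left v y x :=
    fun h => (kinkedRes w k left _).symm h
  have trans : ∀ {v : Fin (n + 1) → Bool} {x y z : BraidPt m (n + 1)},
      kinkedRes w k left v x y → kinkedRes w k left v y z → kinkedRes w k left v x z :=
    fun h h' => (kinkedRes w k left _).trans h h'
  have hc := closure_cross_of_pos w hpos
  have lo_of : ∀ {v : Fin (n + 1) → Bool} {x : BraidPt m (n + 1)} {i : Fin (m + 1)},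
      x = .lo k i ∨ x = .hi k i → kinkedRes w k left v (.lo k i) x := by
    rintro v x i (rfl | rfl)
    · exact (kinkedRes w k left v).refl _
    · exact kinkedRes_level w k left v i
  have loop_rel : ∀ u, kinkedRes w k left (ins k true u) (.lo k (stringAt w k left))
      (BraidPt.skip k (.bottom k (stringAt w k !left))) := fun u =>
    trans (kinkedRes_string w k left _ hpos (ins_same k true u))
      (symm (kinkedRes_lo w k left _ (stringAt_ne w k left)))
  refine
    { cross_eq := closure_cross_succAbove w k
      rel_iff := kinkedRes_skip_iff w k left hpos
      not_rel_loop := fun u p h => ?_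
      loop_or := fun u x => ?_
      exists_rel := fun u x => ?_
      loop_rel := loop_rel
      kink_merge := fun u => ?_
      kink := fun u => ?_ }
  · have := toResolved_eq_of_kinkedRes w k left _ hpos h
    have := (toResolved_skip w k left _ p).symm.trans this
    rw [toResolved_loop, ins_same] at this
    simp at this
  · change kinkedRes w k left _ x _ ∨ ∃ p, kinkedRes w k left _ (BraidPt.skip k p) x
    rcases BraidPt.exists_skip_or k x with ⟨p, rfl⟩ | ⟨i, hi⟩
    · exact Or.inr ⟨p, (kinkedRes w k left _).refl _⟩
    · by_cases h : i = stringAt w k left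
      · subst h
        exact Or.inl (symm (lo_of hi))
      · exact Or.inr ⟨.bottom k i, trans (kinkedRes_lo w k left _ h) (lo_of hi)⟩
  · change ∃ p, kinkedRes w k left _ (BraidPt.skip k p) x
    rcases BraidPt.exists_skip_or k x with ⟨p, rfl⟩ | ⟨i, hi⟩
    · exact ⟨p, (kinkedRes w k left _).refl _⟩
    · by_cases h : i = stringAt w k left
      · subst h
        exact ⟨_, trans (symm (loop_rel u)) (lo_of hi)⟩
      · exact ⟨.bottom k i, trans (kinkedRes_lo w k left _ h) (lo_of hi)⟩
  · change kinkedRes w k left _ ((closure w).cross k 0) ((closure w).cross k 2)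
    rw [hc]
    exact trans (symm (kinkedRes_turn w k left _ hpos (ins_same k true u)))
      (kinkedRes_level w k left _ _)
  · change (kinkedRes w k left _ ((closure w).cross k 0) _ ∧
      kinkedRes w k left _ ((closure w).cross k 2) _) ∨
      (kinkedRes w k left _ ((closure w).cross k 0) _ ∧
      kinkedRes w k left _ ((closure w).cross k 2) _)
    rw [hc]
    have hq := kinkedRes_lo w k left (ins k false u) (stringAt_ne w k left)
    have hl := fun i => kinkedRes_level w k left (ins k false u) i
    -- At a positive crossing end `0` is the lower right one and end `2` the upper left one, so the
    -- side of the handle decides which of them lies on the loop.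
    cases left
    · exact Or.inl ⟨(kinkedRes w k _ _).refl _, trans (symm (hl _)) (symm hq)⟩
    · exact Or.inr ⟨symm hq, symm (hl _)⟩

end

/-! ## The image of the invariant -/

theorem surgery_minus_of_split {P : Type} [Finite P] {r r' : Setoid P} {a b : P}
    (h : IsSurgery r r' a b) (hab : r a b) (hab' : ¬ r' a b) :
    surgery r r' a b (Finsupp.single (fun _ => .minus) 1) =
      Finsupp.single (fun _ => .minus) 1 := by
  ext l'
  simp only [surgery, ofCoeff_single, surgeryCoeff, hab, hab', not_true_eq_false,
    not_false_eq_true, and_true, if_true, false_and, if_false, Finsupp.single_apply]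
  by_cases C : (fun _ => Gen.minus) = l'
  · subst C
    simp [comulCoeff]
  · rw [if_neg C]
    split_ifs with C'
    · by_contra hne
      have hl : l' (Quotient.mk r' a) = .minus ∧ l' (Quotient.mk r' b) = .minus := by
        cases ha : l' (Quotient.mk r' a) <;> cases hb : l' (Quotient.mk r' b) <;>
          simp_all [comulCoeff]
      refine C (funext fun y => ?_)
      obtain ⟨p, rfl⟩ := Quotient.exists_rep y
      by_cases hp : r' p a
      · rw [mk_congr hp, hl.1]
      · by_cases hp' : r' p b
        · rw [mk_congr hp', hl.2]
        · rw [C' p (fun k => hp ((h.symm.rel_iff hp hp').1 k))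
            (fun k => hp' ((h.symm.rel_iff hp hp').1 k))]
    · rfl

section

variable {m n : ℕ} (w : BraidWord m (n + 1)) (k : Fin (n + 1)) (left : Bool)

/-- The oriented resolution passes straight through crossing `k`, so the two arcs of the handle lie
on one circle beforehand. The handle must then split it, and `Δ u₋ = u₋ ⊗ u₋` applies. -/
theorem handlePart_psiChain : handlePart w k left (psiChain w) =
    Finsupp.single (⟨orientedRes w, fun _ => .minus⟩ : (kinked w k left).State) 1 := by
  set j := stringAt w k left
  have hturn : turn w (orientedRes w) k = 1 := turn_of_ne w (by simp [orientedRes])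
  have h1 : (closure w).res (orientedRes w) (.bottom k.castSucc j) (.bottom k.succ j) := by
    have h2 := handleRes_through w 0 0 j (v := orientedRes w) (k := k) (i := j)
      (by rw [hturn]; rfl)
    rw [handleRes_self] at h2
    have h3 := res_bottom_top w (orientedRes w) k.castSucc j
    rw [BraidPt.top_castSucc] at h3
    exact Setoid.trans' _ h3 h2
  have h2 : ¬ handleRes w k.castSucc k.succ j (orientedRes w) (.bottom k.castSucc j)
      (.bottom k.succ j) := fun h2 =>
    handleRes_bottom_not_iff w (castSucc_ne_succ k) j (orientedRes w) ⟨fun _ => h2, fun _ => h1⟩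
  rw [psiChain, ← Diagram.block_single]
  refine ((closure w).handleMap_block _ _ _ _).trans ?_
  refine (congrArg _ (surgery_minus_of_split
    ((closure w).isSurgery_handle (.between k.castSucc j) (.between k.succ j)
      (orientedRes w)) h1 h2)).trans ?_
  exact (kinked w k left).block_single (orientedRes w) _

theorem kinkPart_psiChain (hpos : (w k).positive = true) :
    kinkPart w k left (psiChain (resolve w k)) =
      Finsupp.single (⟨orientedRes w, fun _ => .minus⟩ : (kinked w k left).State) 1 := by
  -- Positivity of the crossing matters here: its oriented resolution is the `0`-resolution, where
  -- `ρ₁` takes its values.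
  have hv : orientedRes w = ins k false (orientedRes (resolve w k)) :=
    (eq_ins_iff k).2 ⟨by simp [orientedRes, hpos], fun _ => rfl⟩
  rw [hv]
  exact (isKink_kinked w k left hpos).rho₁_minus (orientedRes (resolve w k))

end

end Khov

end

theorem mainTheorem5 (m n : ℕ) (w : Khov.BraidWord m (n + 1)) (k : Fin (n + 1))
    (hpos : (w k).positive = true) (left : Bool) :
    ∃ (hh : Khov.IsChainMap (Khov.handlePart w k left))
      (hk : Khov.IsQuasiIso (Khov.kinkPart w k left)),
      Khov.resolutionMap hh hk (Khov.psi w) = Khov.psi (Khov.resolve w k) ∨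
        Khov.resolutionMap hh hk (Khov.psi w) = - Khov.psi (Khov.resolve w k) := by
  refine ⟨Khov.isChainMap_handlePart w k left, (Khov.isKink_kinked w k left hpos).isQuasiIso_rho₁,
    Or.inl ?_⟩
  -- Moving the inverse of `ρ₁` to the other side leaves an equality of two chains in the complex of
  -- the kinked diagram.
  refine (LinearEquiv.symm_apply_eq _).2 ?_
  refine congrArg Submodule.Quotient.mk (Subtype.ext ?_)
  exact (Khov.handlePart_psiChain w k left).trans
    (Khov.kinkPart_psiChain w k left hpos).symm
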